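/- Let $\mathbb S^2\subset\mathbb R^3$ be the unit sphere with its surface measure, and let the unit square $[0,1]^2$ carry Lebesgue measure. For a finite non-empty set $P$ in a universe $U$ of finite measure $\mu(U)>0$ and a class $\mathcal X$ of subsets of $U$ put $$\mathbf D(P,\mathcal X)=\sup_{X\in\mathcal X}\left|\frac{|P\cap X|}{|P|}-\frac{\mu(X)}{\mu(U)}\right| .$$ A spherical convex set is a closed subset of $\mathbb S^2$ that is contained in an open hemisphere and contains, with any two of its points, the geodesic (shorter great-circle arc) joining them; let $\mathcal C$ be the class of these sets, and let $\mathcal R$ be the class of closed axis-parallel rectangles in $[0,1]^2$. The Lambert equal-area map $\phi:[0,1]^2\to\mathbb S^2$ is $$\phi(x,y)=\bigl(2\sqrt{y-y^2}\cos 2\pi x,\;2\sqrt{y-y^2}\sin 2\pi x,\;1-2y\bigr).$$ The Hammersley set is $H_N=\{(i/N,\,r(i)) : 0\le i<N\}$, where $r(i)=\sum_j d_j2^{-j-1}$ for $i=\sum_j d_j2^j$ in binary. **Theorem.** The sets $P_N=\phi(H_N)$ form an efficient deterministic sampling of $\mathbb S^2$ with discrepancy $O(\sqrt{\log N/N})$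 against all spherical convex sets. Precisely: 1. (Efficiency) There is a Turing machine that, given $N$ and $i<N$ in binary, outputs in time polynomial in the length of this input (that is, polynomial in $\log N$) natural numbers $a,b,c,d$ with $b,d\neq0$, $a/b,c/d\in[0,1]$ such that the $i$-th point $\phi(i/N,r(i))$ equals $\phi(a/b,c/d)$. 2. For every $N$, both $H_N$ and $P_N$ have exactly $N$ elements. 3. There is a constant $C$ with $\mathbf D(H_N,\mathcal R)\le C\,\frac{\log N}{N}$ for all $N\ge2$. 4. There is a constant $C$ with $\mathbf D(P_N,\mathcal C)\le C\sqrt{\frac{\log N}{N}}$ for all $N\ge2$. 5. The same bound holds for any other optimal point set: for every $C$ there is $C'$ such that for all $N\ge2$ and every $N$-point set $Q\subset[0,1]^2$ with $\mathbf D(Q,\mathcal R)\le C\,\frac{\log N}{N}$ one has $\mathbf D(\phi(Q),\mathcal C)\le C'\sqrt{\frac{\log N}{N}}$. -/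

import Mathlib

open MeasureTheory Set
open scoped unitInterval

noncomputable section

/-! ### Discrepancy -/

/-- The discrepancy of a finite point collection `P` in the universe `U` (with its volume `μ`)
with respect to a class `𝒳` of subsets of `U`:
the supremum over `X ∈ 𝒳` of `| |P ∩ X| / |P| - μ X / μ U |`. -/
def discrepancy {U : Type*} [MeasurableSpace U] (μ : Measure U) (𝒳 : Set (Set U))
    (P : Finset U) : ℝ :=
  sSup ((fun X : Set U =>
    |(((P : Set U) ∩ X).ncard : ℝ) / (P.card : ℝ) - μ.real X / μ.real univ|) '' 𝒳)

/-- The supremum in the definition of the discrepancy is over a bounded set of reals. -/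
theorem le_discrepancy {U : Type*} [MeasurableSpace U] (μ : Measure U) [IsFiniteMeasure μ]
    (𝒳 : Set (Set U)) (P : Finset U) {X : Set U} (hX : X ∈ 𝒳) :
    |(((P : Set U) ∩ X).ncard : ℝ) / (P.card : ℝ) - μ.real X / μ.real univ|
      ≤ discrepancy μ 𝒳 P := by
  refine le_csSup ⟨1, ?_⟩ (mem_image_of_mem _ hX)
  rintro _ ⟨Y, -, rfl⟩
  have h1 : (((P : Set U) ∩ Y).ncard : ℝ) / (P.card : ℝ) ≤ 1 := by
    refine div_le_one_of_le₀ ?_ (Nat.cast_nonneg _)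
    have := ncard_le_ncard (inter_subset_left : (P : Set U) ∩ Y ⊆ P) P.finite_toSet
    rw [ncard_coe_finset] at this
    exact_mod_cast this
  have h2 : μ.real Y / μ.real univ ≤ 1 :=
    div_le_one_of_le₀ (measureReal_mono (subset_univ _)) measureReal_nonneg
  have h3 : 0 ≤ (((P : Set U) ∩ Y).ncard : ℝ) / (P.card : ℝ) := by positivity
  have h4 : 0 ≤ μ.real Y / μ.real univ := by positivity
  exact abs_le.2 ⟨by linarith, by linarith⟩

/-- Closed axis-aligned rectangles in the unit square. -/
def axisRectangles : Set (Set (I × I)) :=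
  {R | ∃ a b : I × I, a ≤ b ∧ R = Icc a b}

/-! ### The sphere and its convex sets -/

/-- The unit sphere in Euclidean three-space. -/
abbrev Sphere2 : Type := Metric.sphere (0 : EuclideanSpace ℝ (Fin 3)) 1

/-- The surface measure on the unit sphere. -/
def surfaceMeasure : Measure Sphere2 :=
  (volume : Measure (EuclideanSpace ℝ (Fin 3))).toSphere

/-- The geodesic (shorter arc of a great circle) joining two non-antipodal points `p`, `q`:
the points of the sphere in the convex cone spanned by `p` and `q`. -/
def geodesicArc (p q : Sphere2) : Set Sphere2 :=
  {z | ∃ a b : ℝ, 0 ≤ a ∧ 0 ≤ b ∧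
    (z : EuclideanSpace ℝ (Fin 3)) =
      a • (p : EuclideanSpace ℝ (Fin 3)) + b • (q : EuclideanSpace ℝ (Fin 3))}

/-- Spherical convex sets: closed sets, contained in an open hemisphere, that contain
the geodesic joining any two of their points. -/
def sphericalConvexSets : Set (Set Sphere2) :=
  {C | IsClosed C ∧
    (∃ v : Sphere2, ∀ z ∈ C,
      0 < inner ℝ (v : EuclideanSpace ℝ (Fin 3)) (z : EuclideanSpace ℝ (Fin 3))) ∧
    ∀ p ∈ C, ∀ q ∈ C, geodesicArc p q ⊆ C}

/-! ### The Lambert equal-area map -/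

/-- The Lambert equal-area map
`(x, y) ↦ (2 √(y - y²) cos (2πx), 2 √(y - y²) sin (2πx), 1 - 2y)`
from the unit square to the sphere. -/
def lambert (p : I × I) : Sphere2 :=
  ⟨!₂[2 * √((p.2 : ℝ) - (p.2 : ℝ) ^ 2) * Real.cos (2 * Real.pi * (p.1 : ℝ)),
      2 * √((p.2 : ℝ) - (p.2 : ℝ) ^ 2) * Real.sin (2 * Real.pi * (p.1 : ℝ)),
      1 - 2 * (p.2 : ℝ)], by
    have hy : 0 ≤ (p.2 : ℝ) - (p.2 : ℝ) ^ 2 := by nlinarith [p.2.2.1, p.2.2.2]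
    have hs := Real.sq_sqrt hy
    have ht := Real.sin_sq_add_cos_sq (2 * Real.pi * (p.1 : ℝ))
    rw [mem_sphere_zero_iff_norm, EuclideanSpace.norm_eq, Real.sqrt_eq_one]
    simp only [Real.norm_eq_abs, sq_abs, Fin.sum_univ_three, Matrix.cons_val]
    rw [mul_pow, mul_pow, mul_pow, mul_pow, hs]
    linear_combination (4 * ((p.2 : ℝ) - (p.2 : ℝ) ^ 2)) * ht⟩

open Classical in
/-- The image of a finite point collection in the unit square under the Lambert map. -/
def lambertImage (Q : Finset (I × I)) : Finset Sphere2 :=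
  Q.image lambert

/-! ### The Hammersley point set -/

/-- The base two radical inverse (van der Corput) of `n`: if `n = ∑ d_j 2 ^ j` with binary
digits `d_j`, then it is `∑ d_j / 2 ^ (j + 1)`. -/
def radicalInverse (n : ℕ) : ℝ :=
  ∑ j ∈ Finset.range n.size, ((n.testBit j).toNat : ℝ) / 2 ^ (j + 1)

theorem radicalInverse_mem (n : ℕ) : radicalInverse n ∈ I := by
  constructor
  · unfold radicalInverse
    positivity
  · have h : ∀ m : ℕ, ∑ j ∈ Finset.range m, (1 : ℝ) / 2 ^ (j + 1) = 1 - 1 / 2 ^ m := by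
      intro m
      induction m with
      | zero => simp
      | succ m ih => rw [Finset.sum_range_succ, ih, pow_succ]; field_simp; ring
    calc radicalInverse n ≤ ∑ j ∈ Finset.range n.size, (1 : ℝ) / 2 ^ (j + 1) := by
          refine Finset.sum_le_sum fun j _ => ?_
          have : ((n.testBit j).toNat : ℝ) ≤ 1 := by exact_mod_cast Bool.toNat_le _
          gcongr
      _ ≤ 1 := by
          rw [h]
          have : (0 : ℝ) ≤ 1 / 2 ^ n.size := by positivity
          linarith

/-- The point number `i` of the `N`-point Hammersley set, `(i / N, radicalInverse i)`,
for `0 ≤ i < N`. -/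
def hammersleyPoint (N : ℕ) (i : Fin N) : I × I :=
  (⟨(i : ℝ) / N, by positivity,
      div_le_one_of_le₀ (by exact_mod_cast i.2.le) (Nat.cast_nonneg _)⟩,
    ⟨radicalInverse i, radicalInverse_mem i⟩)

open Classical in
/-- The `N`-point Hammersley set in the unit square. -/
def hammersley (N : ℕ) : Finset (I × I) :=
  Finset.univ.image (hammersleyPoint N)

/-! ### Efficiency -/

/-- Pairs of natural numbers, each written in binary. -/
abbrev pairEncoding : Computability.Encoding (ℕ × ℕ) (Bool ⊕ Bool) :=
  Computability.encodingProd Computability.encodingNatBool Computability.encodingNatBool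

/-- A sampling of the sphere (`N` points `s N 0, …, s N (N - 1)` for each `N`) is efficient if
some Turing machine, given `N` and `i` in binary, computes in time polynomial in the length of
this input two fractions `x = a / b` and `y = c / d` in the unit interval such that the point
`s N i` of the sphere has the exact Lambert coordinates `(x, y)`. -/
def IsEfficientSampling (s : (N : ℕ) → Fin N → Sphere2) : Prop :=
  ∃ f : ℕ × ℕ → (ℕ × ℕ) × (ℕ × ℕ),
    Nonempty (Turing.TM2ComputableInPolyTime pairEncoding.encode
      (Computability.encodingProd pairEncoding pairEncoding).encode f) ∧
    ∀ (N : ℕ) (i : Fin N),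
      (f (N, i)).1.2 ≠ 0 ∧ (f (N, i)).2.2 ≠ 0 ∧
      ∃ p : I × I,
        (p.1 : ℝ) = ((f (N, i)).1.1 : ℝ) / ((f (N, i)).1.2 : ℝ) ∧
        (p.2 : ℝ) = ((f (N, i)).2.1 : ℝ) / ((f (N, i)).2.2 : ℝ) ∧
        s N i = lambert p

end

/-!
# Hammersley points on the sphere

*Discrepancy in the square.* A closed rectangle catches the Hammersley points whose indices lie in
an interval of integers and whose radical inverses lie in an interval of reals. The radical inverse
of `2n + e` is `(e + r(n)) / 2`, so splitting the indices by parity halves the interval of indices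
and doubles the interval of values, at the cost of a bounded error; after about `log₂ N` halvings
nothing is left (`abs_count_radicalInverse_sub_le`).

*From the square to the sphere.* The Lambert map preserves relative area (`surfaceMeasure_div`, a
change of variables in the cone over a set on the sphere). It is injective off three sides of the
square, which are degenerate rectangles and hence carry few points. It remains to bound the
discrepancy of the pull-back of a spherical convex set `C`.

On each meridian, `C` is an interval between a lower and an upper height. These are functions of
the longitude of bounded variation, uniformly in `C`: on a quarter of all longitudes, central
projection to a tangent plane of the equator makes `C` a convex set, so the upper height `w` there
is a concave, in particular quasi-concave, function of the tangent `t` of the longitude.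
The height on the sphere is `w / √(1 + t² + w²)`, which increases with `w` and is Lipschitz in `t`
with constant one, and these two facts bound its variation (`hasVariationLE_of_quasiconcave`).
Since `w` may be infinite at the poles, `w / √(1 + w²)` takes its place (`gnomonicHeight`).

Cut the square into `m` vertical strips. In each strip, the pull-back of `C` is covered by one
rectangle and its complement by two, and the areas of all these rectangles add up to
`1 + O(1 / m)` because of the bounded variation (`exists_region_bound`). A set function that
exceeds the area of rectangles by at most `D` therefore exceeds the area of the pull-back, and of
its complement, by at most `O(1 / m + m D)`. With `D = O(log N / N)` and `m` about `√(N / log N)`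
this is the asserted bound.

*Efficiency.* The numerator of the radical inverse of `i` has the reversed binary digits of `i`,
and its denominator is a power of two, so a machine with a few stacks produces the coordinates in
linear time (`HammersleyMachine.computable`).
-/

noncomputable section

/-! ### Binary digits and the radical inverse -/

theorem radicalInverse_eq_sum {n m : ℕ} (h : n.size ≤ m) :
    radicalInverse n = ∑ j ∈ Finset.range m, ((n.testBit j).toNat : ℝ) / 2 ^ (j + 1) := by
  unfold radicalInverse
  refine Finset.sum_subset (Finset.range_mono h) fun j _ hj => ?_
  have h1 : n < 2 ^ j :=
    (Nat.size_le.1 le_rfl).trans_le (Nat.pow_le_pow_right two_pos (by simpa using hj))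
  simp [Nat.testBit_eq_false_of_lt h1]

theorem radicalInverse_zero : radicalInverse 0 = 0 := by
  simp [radicalInverse]

/-- Prepending a lowest binary digit `b` to `n` shifts its radical inverse right by one place
and puts `b` in the first place after the binary point. -/
theorem radicalInverse_bit (b : Bool) (n : ℕ) :
    radicalInverse (Nat.bit b n) = ((b.toNat : ℝ) + radicalInverse n) / 2 := by
  have h : (Nat.bit b n).size ≤ n.size + 1 := by
    rw [Nat.size_le, pow_succ]
    have := Nat.size_le.1 (le_refl n.size)
    rw [Nat.bit_val]
    have := b.toNat_le
    omega
  rw [radicalInverse_eq_sum h, Finset.sum_range_succ', add_div, add_comm, radicalInverse,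
    Finset.sum_div]
  congr 1
  · simp
  · refine Finset.sum_congr rfl fun j _ => ?_
    rw [Nat.testBit_bit_succ, pow_succ _ (j + 1)]
    field_simp

theorem radicalInverse_lt_one (n : ℕ) : radicalInverse n < 1 := by
  induction n using Nat.binaryRec with
  | zero => simp [radicalInverse_zero]
  | bit b n ih =>
    rw [radicalInverse_bit]
    have : (b.toNat : ℝ) ≤ 1 := by exact_mod_cast b.toNat_le
    linarith

theorem radicalInverse_injective : Function.Injective radicalInverse := by
  intro m
  induction m using Nat.binaryRec' with
  | zero =>
    intro n
    induction n using Nat.binaryRec' with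
    | zero => simp
    | bit b n hb ih =>
      intro h
      rw [radicalInverse_zero, radicalInverse_bit] at h
      have h0 := (radicalInverse_mem n).1
      cases b
      · have : n = 0 := (ih (by rw [radicalInverse_zero]; norm_num at h; linarith)).symm
        simp [this] at hb
      · norm_num at h; linarith
  | bit a m ha ih =>
    intro n h
    obtain ⟨b, n, rfl⟩ : ∃ b k, n = Nat.bit b k := ⟨_, _, (Nat.bit_bodd_div2 n).symm⟩
    rw [radicalInverse_bit, radicalInverse_bit] at h
    have hm := radicalInverse_lt_one m
    have hm' := (radicalInverse_mem m).1
    have hn := radicalInverse_lt_one n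
    have hn' := (radicalInverse_mem n).1
    cases a <;> cases b <;> norm_num at h <;> first | (rw [ih h]) | (exfalso; linarith)

/-- The natural number with the given binary digits, lowest digit first. -/
def ofDigitList : List Bool → ℕ
  | [] => 0
  | b :: l => Nat.bit b (ofDigitList l)

theorem ofDigitList_append (l l' : List Bool) :
    ofDigitList (l ++ l') = ofDigitList l + 2 ^ l.length * ofDigitList l' := by
  induction l with
  | nil => simp [ofDigitList]
  | cons b l ih =>
    simp only [List.cons_append, ofDigitList, ih, Nat.bit_val, List.length_cons, pow_succ]
    ring

open Computability in
theorem encodeNat_bit {b : Bool} {n : ℕ} (h : n = 0 → b = true) :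
    encodeNat (Nat.bit b n) = b :: encodeNat n := by
  have hc : ((Nat.bit b n : ℕ) : Num) = Num.bit0 (n : Num) + (if b then 1 else 0) := by
    cases b <;> simp [Nat.bit_val, Num.bit0_of_bit0, two_mul]
  rcases Nat.eq_zero_or_pos n with rfl | hn
  · rw [h rfl]; rfl
  · unfold encodeNat
    rw [hc]
    have hne : (n : Num) ≠ 0 := by
      intro h0
      have := congrArg (fun x : Num => (x : ℕ)) h0
      simp at this; omega
    cases hx : (n : Num) with
    | zero => exact absurd hx hne
    | pos p => cases b <;> rfl

open Computability in
theorem encodeNat_zero : encodeNat 0 = [] := rfl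

theorem ofDigitList_ne_zero_of_getLast {l : List Bool} (hl : l ≠ [])
    (h : l.getLast hl = true) : ofDigitList l ≠ 0 := by
  induction l with
  | nil => exact absurd rfl hl
  | cons b l ih =>
    rcases eq_or_ne l [] with rfl | hne
    · simp only [List.getLast_singleton] at h
      simp [h, ofDigitList]
    · rw [List.getLast_cons hne] at h
      simpa [ofDigitList, Nat.bit_eq_zero_iff] using fun h0 => absurd h0 (ih hne h)

open Computability in
/-- A digit list without superfluous zeros is the binary encoding of the number it stands for. -/
theorem encodeNat_ofDigitList {l : List Bool} (h : ∀ hl : l ≠ [], l.getLast hl = true) :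
    encodeNat (ofDigitList l) = l := by
  induction l with
  | nil => rfl
  | cons b l ih =>
    rcases eq_or_ne l [] with rfl | hne
    · have := h (by simp)
      simp only [List.getLast_singleton] at this
      rw [this]; rfl
    · have h' : l.getLast hne = true := by
        have := h (by simp)
        rwa [List.getLast_cons hne] at this
      rw [ofDigitList, encodeNat_bit, ih fun _ => h']
      exact fun h0 => absurd h0 (ofDigitList_ne_zero_of_getLast hne h')

open Computability in
theorem encodeNat_two_pow (n : ℕ) :
    encodeNat (2 ^ n) = List.replicate n false ++ [true] := by
  induction n with
  | zero => rfl
  | succ n ih =>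
    have : 2 ^ (n + 1) = Nat.bit false (2 ^ n) := by simp [Nat.bit_val, pow_succ, mul_comm]
    rw [this, encodeNat_bit (by simp), ih]
    rfl

/-- The digits of the numerator of the radical inverse: the reversed digit list, stripped of
its superfluous zeros. -/
def numeratorDigits (l : List Bool) : List Bool :=
  (l.dropWhile (!·)).reverse

theorem ofDigitList_numeratorDigits (l : List Bool) :
    ofDigitList (numeratorDigits l) = ofDigitList l.reverse := by
  unfold numeratorDigits
  induction l with
  | nil => rfl
  | cons b l ih =>
    cases b
    · simp [ih, ofDigitList_append, ofDigitList]
    · simp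

open Computability in
theorem encodeNat_numeratorDigits (l : List Bool) :
    encodeNat (ofDigitList (numeratorDigits l)) = numeratorDigits l := by
  refine encodeNat_ofDigitList fun hl => ?_
  unfold numeratorDigits at hl ⊢
  rw [List.getLast_reverse]
  have := List.head_dropWhile_not (p := (!·)) (l := l) (by simpa using hl)
  simpa using this

open Computability in
theorem radicalInverse_eq_div (n : ℕ) :
    radicalInverse n =
      (ofDigitList (encodeNat n).reverse : ℝ) / (2 ^ (encodeNat n).length : ℕ) := by
  induction n using Nat.binaryRec' with
  | zero => simp [radicalInverse_zero, encodeNat_zero, ofDigitList]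
  | bit b n hb ih =>
    rw [radicalInverse_bit, ih, encodeNat_bit hb, List.reverse_cons, ofDigitList_append]
    simp only [ofDigitList, List.length_cons, List.length_reverse, Nat.bit_val]
    push_cast
    rw [pow_succ]
    field_simp
    ring

/-! ### A linear-time machine for the coordinates -/

namespace HammersleyMachine

open Turing Turing.TM2 Computability

/-- The contents of the machine: input, the digits of `N`, two stacks for the digits of the index
`i`, and output. -/
inductive Stack
  | input | size | index | reversed | output
  deriving DecidableEq

instance : Fintype Stack :=
  ⟨{.input, .size, .index, .reversed, .output}, fun k => by cases k <;> simp⟩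

/-- The stack alphabets: the encoding alphabets for input and output, and bits elsewhere. -/
@[reducible] def Alphabet : Stack → Type
  | .input => Bool ⊕ Bool
  | .size => Bool
  | .index => Bool
  | .reversed => Bool
  | .output => (Bool ⊕ Bool) ⊕ (Bool ⊕ Bool)

/-- The phases of the machine, one for each loop: read the input, write the denominator of the
second coordinate, write its numerator, write the denominator of the first coordinate, write
its numerator. -/
inductive Phase
  | read | writePower | writeReversed | writeSize | writeIndex
  deriving DecidableEq

instance : Fintype Phase :=
  ⟨{.read, .writePower, .writeReversed, .writeSize, .writeIndex}, fun k => by cases k <;> simp⟩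

/-- The internal state: the symbol read last, and a flag telling whether a nonzero digit
has been seen. -/
abbrev State : Type := Option (Bool ⊕ Bool) × Bool

/-- The bit in the symbol read last. -/
def State.bit (s : State) : Bool := (s.1.map (Sum.elim id id)).getD false

/-- Pop a bit from a stack of bits into the internal state. -/
def popBit (s : State) (b : Option Bool) : State := (b.map .inl, s.2)

/-- The program. All loops pop one symbol per step; a loop ends when its stack is empty.
Output is a stack, so the four output numbers are written in reverse order, each one starting
from its highest digit. -/
def program : Phase → Stmt Alphabet Phase State
  | .read =>
    .pop .input (fun s a => (a, s.2)) <|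
    .branch (fun s => s.1.isSome)
      (.branch (fun s => (s.1.map Sum.isLeft).getD false)
        (.push .size State.bit <| .goto fun _ => .read)
        (.push .index State.bit <| .goto fun _ => .read))
      (.push .output (fun _ => .inr (.inr true)) <| .goto fun _ => .writePower)
  | .writePower =>
    .pop .index popBit <|
    .branch (fun s => s.1.isSome)
      (.push .reversed State.bit <| .push .output (fun _ => .inr (.inr false)) <|
        .goto fun _ => .writePower)
      (.goto fun _ => .writeReversed)
  | .writeReversed =>
    .pop .reversed popBit <|
    .branch (fun s => s.1.isSome)
      (.push .index State.bit <|
        .load (fun s => (s.1, s.2 || s.bit)) <|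
        .branch (fun s => s.2)
          (.push .output (fun s => .inr (.inl s.bit)) <| .goto fun _ => .writeReversed)
          (.goto fun _ => .writeReversed))
      (.load (fun s => (s.1, false)) <| .goto fun _ => .writeSize)
  | .writeSize =>
    .pop .size popBit <|
    .branch (fun s => s.1.isSome)
      (.push .output (fun s => .inl (.inr s.bit)) <| .goto fun _ => .writeSize)
      (.goto fun _ => .writeIndex)
  | .writeIndex =>
    .pop .index popBit <|
    .branch (fun s => s.1.isSome)
      (.push .output (fun s => .inl (.inl s.bit)) <| .goto fun _ => .writeIndex)
      .halt

/-- The machine turning the binary digits of `N` and `i` into those of the coordinates of the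
point number `i` of the `N`-point Hammersley set. -/
def machine : FinTM2 :=
  @FinTM2.mk Stack _ _ .input .output Alphabet Phase .read _ State (none, false) _
    (inferInstanceAs (Fintype (Bool ⊕ Bool))) program

/-- The stack contents given by five lists. -/
def contents (a : List (Bool ⊕ Bool)) (b c d : List Bool)
    (e : List ((Bool ⊕ Bool) ⊕ (Bool ⊕ Bool))) : ∀ k, List (Alphabet k)
  | .input => a
  | .size => b
  | .index => c
  | .reversed => d
  | .output => e

section

variable (a a' : List (Bool ⊕ Bool)) (b b' c c' d d' : List Bool)
  (e e' : List ((Bool ⊕ Bool) ⊕ (Bool ⊕ Bool)))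

@[simp] theorem contents_input : contents a b c d e .input = a := rfl
@[simp] theorem contents_size : contents a b c d e .size = b := rfl
@[simp] theorem contents_index : contents a b c d e .index = c := rfl
@[simp] theorem contents_reversed : contents a b c d e .reversed = d := rfl
@[simp] theorem contents_output : contents a b c d e .output = e := rfl

@[simp] theorem update_contents_input :
    Function.update (contents a b c d e) .input a' = contents a' b c d e := by
  funext k; cases k <;> rfl
@[simp] theorem update_contents_size :
    Function.update (contents a b c d e) .size b' = contents a b' c d e := by
  funext k; cases k <;> rfl
@[simp] theorem update_contents_index :
    Function.update (contents a b c d e) .index c' = contents a b c' d e := by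
  funext k; cases k <;> rfl
@[simp] theorem update_contents_reversed :
    Function.update (contents a b c d e) .reversed d' = contents a b c d' e := by
  funext k; cases k <;> rfl
@[simp] theorem update_contents_output :
    Function.update (contents a b c d e) .output e' = contents a b c d e' := by
  funext k; cases k <;> rfl

/-- `Runs n x y`: the machine takes exactly `n` steps from the configuration `x` to `y`. -/
def Runs (n : ℕ) (x y : Cfg Alphabet Phase State) : Prop :=
  (flip bind (step program))^[n] (some x) = some y

end

theorem Runs.trans {m n : ℕ} {x y z : Cfg Alphabet Phase State} (h : Runs m x y)
    (h' : Runs n y z) : Runs (n + m) x z := by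
  unfold Runs at *
  rw [Function.iterate_add_apply, h, h']

theorem Runs.head {n : ℕ} {x y z : Cfg Alphabet Phase State} (h : step program x = some y)
    (h' : Runs n y z) : Runs (n + 1) x z :=
  Runs.trans (m := 1) h h'

theorem runs_one {x y : Cfg Alphabet Phase State} (h : step program x = some y) : Runs 1 x y := h

variable {a : List (Bool ⊕ Bool)} {b c d : List Bool}
  {e : List ((Bool ⊕ Bool) ⊕ (Bool ⊕ Bool))}

theorem runs_read (p q : List Bool) (v : State) :
    Runs (p.length + q.length + 1)
      ⟨some .read, v, contents (p.map .inl ++ q.map .inr) b c d e⟩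
      ⟨some .writePower, (none, v.2),
        contents [] (p.reverse ++ b) (q.reverse ++ c) d (.inr (.inr true) :: e)⟩ := by
  induction p generalizing b v with
  | nil =>
    induction q generalizing c v with
    | nil => exact runs_one (by simp [program])
    | cons x q ih =>
      have := ih (c := x :: c) (v := (some (.inr x), v.2))
      have h2 := Runs.head
        (x := ⟨some .read, v, contents (([] : List Bool).map .inl ++ (x :: q).map .inr) b c d e⟩)
        (by simp [program, State.bit]) this
      convert h2 using 1
      · simp
      · simp
  | cons x p ih =>
    have := ih (b := x :: b) (v := (some (.inl x), v.2))
    have h2 := Runs.head (x := ⟨some .read, v, contents ((x :: p).map .inl ++ q.map .inr) b c d e⟩)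
      (by simp [program, State.bit]) this
    convert h2 using 1
    · simp; ring
    · simp

theorem runs_writePower (q : List Bool) (v : State) :
    Runs (q.length + 1)
      ⟨some .writePower, v, contents a b q d e⟩
      ⟨some .writeReversed, (none, v.2),
        contents a b [] (q.reverse ++ d) (List.replicate q.length (.inr (.inr false)) ++ e)⟩ := by
  induction q generalizing v d e with
  | nil => exact runs_one (by simp [program, popBit])
  | cons x q ih =>
    have := ih (d := x :: d) (e := .inr (.inr false) :: e) (v := (some (.inl x), v.2))
    have h2 := Runs.head (x := ⟨some .writePower, v, contents a b (x :: q) d e⟩)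
      (by simp [program, popBit, State.bit]) this
    convert h2 using 1
    · simp
    · simp [List.replicate_succ']

theorem runs_writeReversed (q : List Bool) (v : State) :
    Runs (q.length + 1)
      ⟨some .writeReversed, v, contents a b c q e⟩
      ⟨some .writeSize, (none, false),
        contents a b (q.reverse ++ c) []
          (((if v.2 then q.reverse else numeratorDigits q).map fun x => .inr (.inl x)) ++ e)⟩ := by
  induction q generalizing v c e with
  | nil => exact runs_one (by simp [program, popBit, numeratorDigits])
  | cons x q ih =>
    have := ih (c := x :: c) (e := if v.2 || x then .inr (.inl x) :: e else e)
      (v := (some (.inl x), v.2 || x))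
    have h2 := Runs.head (x := ⟨some .writeReversed, v, contents a b c (x :: q) e⟩)
      (by
        obtain ⟨v1, v2⟩ := v
        cases v2 <;> cases x <;> simp [program, popBit, State.bit]) this
    convert h2 using 1
    · simp
    · obtain ⟨v1, v2⟩ := v
      cases v2 <;> cases x <;> simp [numeratorDigits]

theorem runs_writeSize (q : List Bool) (v : State) :
    Runs (q.length + 1)
      ⟨some .writeSize, v, contents a q c d e⟩
      ⟨some .writeIndex, (none, v.2),
        contents a [] c d ((q.reverse.map fun x => .inl (.inr x)) ++ e)⟩ := by
  induction q generalizing v e with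
  | nil => exact runs_one (by simp [program, popBit])
  | cons x q ih =>
    have := ih (e := .inl (.inr x) :: e) (v := (some (.inl x), v.2))
    have h2 := Runs.head (x := ⟨some .writeSize, v, contents a (x :: q) c d e⟩)
      (by simp [program, popBit, State.bit]) this
    convert h2 using 1
    · simp
    · simp

theorem runs_writeIndex (q : List Bool) (v : State) :
    Runs (q.length + 1)
      ⟨some .writeIndex, v, contents a b q d e⟩
      ⟨none, (none, v.2),
        contents a b [] d ((q.reverse.map fun x => .inl (.inl x)) ++ e)⟩ := by
  induction q generalizing v e with
  | nil => exact runs_one (by simp [program, popBit])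
  | cons x q ih =>
    have := ih (e := .inl (.inl x) :: e) (v := (some (.inl x), v.2))
    have h2 := Runs.head (x := ⟨some .writeIndex, v, contents a b (x :: q) d e⟩)
      (by simp [program, popBit, State.bit]) this
    convert h2 using 1
    · simp
    · simp

/-- The function computed by the machine: numerators and denominators of `i / N` and of the
radical inverse of `i`. The denominator `N` vanishes only for the empty point set. -/
def coordinates (x : ℕ × ℕ) : (ℕ × ℕ) × (ℕ × ℕ) :=
  ((x.2, x.1),
    (ofDigitList (numeratorDigits (encodeNat x.2)), 2 ^ (encodeNat x.2).length))

theorem runs_total (p q : List Bool) :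
    Runs (2 * p.length + 4 * q.length + 5)
      ⟨some .read, (none, false), contents (p.map .inl ++ q.map .inr) [] [] [] []⟩
      ⟨none, (none, false), contents [] [] [] []
        (((q.map Sum.inl ++ p.map Sum.inr).map Sum.inl) ++
          (((numeratorDigits q).map Sum.inl ++
            (List.replicate q.length false ++ [true]).map Sum.inr).map Sum.inr))⟩ := by
  have h := ((((runs_read (b := []) (c := []) (d := []) (e := []) p q (none, false)).trans
    (runs_writePower _ _)).trans (runs_writeReversed _ _)).trans (runs_writeSize _ _)).trans
    (runs_writeIndex _ _)
  convert h using 1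
  · simp; ring
  · simp [Function.comp_def]

/-- The machine computes the Hammersley coordinates, in linear time. -/
def computable : TM2ComputableInPolyTime pairEncoding.encode
    (encodingProd pairEncoding pairEncoding).encode coordinates where
  tm := machine
  inputAlphabet := Equiv.refl _
  outputAlphabet := Equiv.refl _
  time := 4 * Polynomial.X + 5
  outputsFun := fun x =>
    { steps := 2 * (encodeNat x.1).length + 4 * (encodeNat x.2).length + 5
      evals_in_steps := by
        have h := runs_total (encodeNat x.1) (encodeNat x.2)
        unfold Runs at h
        refine (congrArg _ (congrArg some ?_)).trans (h.trans (congrArg some ?_))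
        · refine congrArg (Cfg.mk _ _) ?_
          funext k
          cases k <;> simp [machine, contents, encodingProd, encodingNatBool]
          rfl
        · refine congrArg (Cfg.mk _ _) ?_
          funext k
          cases k <;> simp [machine, contents, encodingProd, encodingNatBool, coordinates,
            encodeNat_numeratorDigits, encodeNat_two_pow]
          rfl
      steps_le_m := by
        simp [encodingProd, encodingNatBool]
        omega }

end HammersleyMachine

open HammersleyMachine in
theorem isEfficientSampling_hammersley :
    IsEfficientSampling (fun N i => lambert (hammersleyPoint N i)) := by
  refine ⟨coordinates, ⟨computable⟩, fun N i => ⟨?_, by simp [coordinates], ?_⟩⟩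
  · exact (i.pos).ne'
  · refine ⟨hammersleyPoint N i, rfl, ?_, rfl⟩
    simp only [coordinates, ofDigitList_numeratorDigits]
    exact radicalInverse_eq_div i

/-! ### Discrepancy of the Hammersley set -/

theorem count_two_mul (p : ℕ → Prop) [DecidablePred p] (n : ℕ) :
    Nat.count p n = Nat.count (fun i => p (2 * i)) ((n + 1) / 2) +
      Nat.count (fun i => p (2 * i + 1)) (n / 2) := by
  induction n with
  | zero => simp
  | succ n ih =>
    rw [Nat.count_succ, ih]
    obtain ⟨k, rfl | rfl⟩ := Nat.even_or_odd' n
    · rw [show (2 * k + 1 + 1) / 2 = k + 1 by omega, show (2 * k + 1) / 2 = k by omega,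
        show 2 * k / 2 = k by omega, Nat.count_succ]
      omega
    · rw [show (2 * k + 1 + 1 + 1) / 2 = k + 1 by omega, show (2 * k + 1 + 1) / 2 = k + 1 by omega,
        show (2 * k + 1) / 2 = k by omega, Nat.count_succ (fun i => p (2 * i + 1))]
      omega

theorem radicalInverse_two_mul (n : ℕ) : radicalInverse (2 * n) = radicalInverse n / 2 := by
  simpa using radicalInverse_bit false n

theorem radicalInverse_two_mul_add_one (n : ℕ) :
    radicalInverse (2 * n + 1) = (1 + radicalInverse n) / 2 := by
  simpa using radicalInverse_bit true n

open Classical in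
/-- Among the `b - a` consecutive indices from `a` on, those with radical inverse below `β`
number `(b - a) β` up to an error of `s + 1`, for `2 ^ s ≥ b - a`: the error grows
by at most one when the interval is halved and the parity of the indices is split off.
The relation `P` stands for one of `<` and `≤`. -/
theorem abs_count_radicalInverse_sub_le (P : ℝ → ℝ → Prop)
    (hlt : ∀ r β, r < β → P r β) (hgt : ∀ r β, β < r → ¬ P r β)
    (hscale : ∀ e r β, P ((e + r) / 2) β ↔ P r (2 * β - e)) (s : ℕ) :
    ∀ (a b : ℕ) (β : ℝ), a ≤ b → 0 ≤ β → β ≤ 1 →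
      |(Nat.count (fun i => P (radicalInverse i) β) b : ℝ) -
        Nat.count (fun i => P (radicalInverse i) β) a - ((b : ℝ) - a) * β| ≤
        ((b : ℝ) - a) / 2 ^ s + s := by
  induction s with
  | zero =>
    intro a b β hab h0 h1
    have e1 := Nat.count_monotone (fun i => P (radicalInverse i) β) hab
    have e2 : Nat.count (fun i => P (radicalInverse i) β) b ≤
        Nat.count (fun i => P (radicalInverse i) β) a + (b - a) := by
      conv_lhs => rw [← Nat.add_sub_cancel' hab, Nat.count_add]
      exact Nat.add_le_add_left (Nat.count_le _) _
    have e1' : (Nat.count (fun i => P (radicalInverse i) β) a : ℝ) ≤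
      Nat.count (fun i => P (radicalInverse i) β) b := by exact_mod_cast e1
    have e2' : (Nat.count (fun i => P (radicalInverse i) β) b : ℝ) ≤
      Nat.count (fun i => P (radicalInverse i) β) a + ((b : ℝ) - a) := by
      rw [← Nat.cast_sub hab]; exact_mod_cast e2
    have hba : (0 : ℝ) ≤ (b : ℝ) - a := by
      rw [sub_nonneg]; exact_mod_cast hab
    rw [abs_le]
    constructor <;> simp <;> nlinarith
  | succ s ih =>
    intro a b β hab h0 h1
    have hpow : (1 : ℝ) / 2 ^ s ≤ 1 := by
      rw [div_le_one (by positivity)]; exact one_le_pow₀ (by norm_num)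
    have hhalf : ∀ n : ℕ, (((n + 1) / 2 : ℕ) : ℝ) + ((n / 2 : ℕ) : ℝ) = n ∧
        (n : ℝ) / 2 ≤ (((n + 1) / 2 : ℕ) : ℝ) ∧ (((n + 1) / 2 : ℕ) : ℝ) ≤ n / 2 + 1 / 2 := by
      intro n
      refine ⟨by norm_cast; omega, ?_, ?_⟩
      · rw [div_le_iff₀ two_pos]; norm_cast; omega
      · rw [← add_div, le_div_iff₀ two_pos]; norm_cast; omega
    obtain ⟨a1, a2, a3⟩ := hhalf a
    obtain ⟨b1, b2, b3⟩ := hhalf b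
    have hs : ∀ d D : ℝ, d ≤ D / 2 + 1 / 2 → d / 2 ^ s + s + 1 / 2 ≤ D / 2 ^ (s + 1) + (s + 1) := by
      intro d D h
      have : d / 2 ^ s ≤ (D / 2 + 1 / 2) / 2 ^ s := by gcongr
      have e : (D / 2 + 1 / 2) / 2 ^ s = D / 2 ^ (s + 1) + 1 / 2 ^ s / 2 := by
        rw [pow_succ]; field_simp
      linarith
    rw [count_two_mul _ b, count_two_mul _ a]
    have heven : (fun i => P (radicalInverse (2 * i)) β) =
        fun i => P (radicalInverse i) (2 * β) := by
      funext i
      rw [radicalInverse_two_mul]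
      simpa using hscale 0 (radicalInverse i) β
    have hodd : (fun i => P (radicalInverse (2 * i + 1)) β) =
        fun i => P (radicalInverse i) (2 * β - 1) := by
      funext i
      rw [radicalInverse_two_mul_add_one]
      simpa using hscale 1 (radicalInverse i) β
    simp only [heven, hodd]
    push_cast
    rcases lt_or_ge β (1 / 2) with hβ | hβ
    · have hz : ∀ n, Nat.count (fun i => P (radicalInverse i) (2 * β - 1)) n = 0 := by
        intro n
        rw [Nat.count_eq_card_filter_range, Finset.card_eq_zero, Finset.filter_eq_empty_iff]
        exact fun i _ => hgt _ _ (by linarith [(radicalInverse_mem i).1])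
      rw [hz, hz]
      have := ih ((a + 1) / 2) ((b + 1) / 2) (2 * β) (by omega) (by linarith) (by linarith)
      refine le_trans ?_ (hs ((((b + 1) / 2 : ℕ) : ℝ) - ((a + 1) / 2 : ℕ)) _ (by linarith))
      rw [abs_le] at this ⊢
      constructor <;> push_cast <;> nlinarith
    · have hz : ∀ n, Nat.count (fun i => P (radicalInverse i) (2 * β)) n = n := by
        intro n
        rw [Nat.count_eq_card_filter_range, Finset.filter_true_of_mem, Finset.card_range]
        exact fun i _ => hlt _ _ (by linarith [radicalInverse_lt_one i])
      rw [hz, hz]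
      have := ih (a / 2) (b / 2) (2 * β - 1) (by omega) (by linarith) (by linarith)
      refine le_trans ?_ (hs (((b / 2 : ℕ) : ℝ) - (a / 2 : ℕ)) _ (by linarith))
      rw [abs_le] at this ⊢
      constructor <;> nlinarith

theorem hammersleyPoint_injective (N : ℕ) : Function.Injective (hammersleyPoint N) := by
  intro i j h
  have : radicalInverse i = radicalInverse j := congrArg (fun p : I × I => (p.2 : ℝ)) h
  exact Fin.ext (radicalInverse_injective this)

theorem card_hammersley (N : ℕ) : (hammersley N).card = N := by
  unfold hammersley
  rw [Finset.card_image_of_injective _ (hammersleyPoint_injective N), Finset.card_univ,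
    Fintype.card_fin]

theorem card_lambertImage_hammersley (N : ℕ) : (lambertImage (hammersley N)).card = N := by
  unfold lambertImage
  rw [Finset.card_image_of_injOn, card_hammersley]
  intro p hp q hq h
  simp only [hammersley, Finset.coe_image, Finset.coe_univ, image_univ, mem_range] at hp hq
  obtain ⟨i, rfl⟩ := hp
  obtain ⟨j, rfl⟩ := hq
  have h2 := congrArg (fun z : Sphere2 => (z : EuclideanSpace ℝ (Fin 3)) 2) h
  have : radicalInverse i = radicalInverse j := by
    simpa [lambert, hammersleyPoint] using h2
  rw [Fin.ext (radicalInverse_injective this)]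

theorem volume_real_Icc_unitSquare {a b : I × I} (h : a ≤ b) :
    (volume : Measure (I × I)).real (Icc a b) =
      ((b.1 : ℝ) - a.1) * ((b.2 : ℝ) - a.2) := by
  rw [Icc_prod_eq, Measure.volume_eq_prod, measureReal_prod_prod]
  have key : ∀ x y : I, x ≤ y → (volume : Measure I).real (Icc x y) = (y : ℝ) - x := by
    intro x y hxy
    simp [measureReal_def, hxy]
  rw [key _ _ h.1, key _ _ h.2]

open Classical in
/-- The first coordinates of the Hammersley points in a rectangle belong to consecutive indices,
and those of the indices whose radical inverses lie in `[a₂, b₂]` are counted by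
`abs_count_radicalInverse_sub_le`, used for `≤ b₂` and for `< a₂`. -/
theorem abs_ncard_hammersley_inter_sub_le {N : ℕ} (hN : 0 < N) {s : ℕ} (hs : N ≤ 2 ^ s)
    {a b : I × I} (hab : a ≤ b) :
    |(((hammersley N : Set (I × I)) ∩ Icc a b).ncard : ℝ) -
      N * (((b.1 : ℝ) - a.1) * ((b.2 : ℝ) - a.2))| ≤ 2 * s + 3 := by
  have hN' : (0 : ℝ) < N := by exact_mod_cast hN
  have ha0 := a.1.2.1
  have ha1 := a.1.2.2
  have hb0 := b.1.2.1
  have hb1 := b.1.2.2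
  have hab1 : (a.1 : ℝ) ≤ b.1 := hab.1
  have hab2 : (a.2 : ℝ) ≤ b.2 := hab.2
  set m : ℕ := ⌈(N : ℝ) * a.1⌉₊ with hm
  set n : ℕ := min N (⌊(N : ℝ) * b.1⌋₊ + 1) with hn
  set p : ℕ → Prop := fun i => (a.2 : ℝ) ≤ radicalInverse i ∧ radicalInverse i ≤ b.2 with hp
  have hmn : m ≤ n := by
    rw [hm, Nat.ceil_le, hn]
    rcases min_choice N (⌊(N : ℝ) * b.1⌋₊ + 1) with h | h <;> rw [h]
    · nlinarith
    · push_cast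
      have := (Nat.lt_floor_add_one ((N : ℝ) * b.1)).le
      nlinarith
  have hnN : n ≤ N := min_le_left _ _
  have hset : (hammersley N : Set (I × I)) ∩ Icc a b =
      ((Finset.univ.filter fun i : Fin N => i.1 ∈ Finset.Ico m n ∧ p i).image
        (hammersleyPoint N) : Finset (I × I)) := by
    ext x
    simp only [hammersley, Finset.coe_image, Finset.coe_univ, image_univ, mem_inter_iff,
      mem_range, Finset.coe_filter, Finset.mem_univ, true_and, mem_image, mem_ofPred_eq]
    have key : ∀ i : Fin N, hammersleyPoint N i ∈ Icc a b ↔ i.1 ∈ Finset.Ico m n ∧ p i := by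
      intro i
      have hi : (i : ℝ) / N ≤ b.1 ↔ (i : ℕ) < n := by
        rw [div_le_iff₀ hN', hn, lt_min_iff, Nat.lt_succ_iff, Nat.le_floor_iff (by positivity),
          mul_comm]
        simp [i.2]
      have hi' : (a.1 : ℝ) ≤ (i : ℝ) / N ↔ m ≤ (i : ℕ) := by
        rw [le_div_iff₀ hN', hm, Nat.ceil_le, mul_comm]
      rw [Finset.mem_Ico, ← hi, ← hi']
      constructor
      · rintro ⟨⟨h1, h2⟩, h3, h4⟩
        exact ⟨⟨h1, h3⟩, h2, h4⟩
      · rintro ⟨⟨h1, h3⟩, h2, h4⟩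
        exact ⟨⟨h1, h2⟩, h3, h4⟩
    constructor
    · rintro ⟨⟨i, rfl⟩, h⟩
      exact ⟨i, (key i).1 h, rfl⟩
    · rintro ⟨i, h, rfl⟩
      exact ⟨⟨i, rfl⟩, (key i).2 h⟩
  have hcard : ((hammersley N : Set (I × I)) ∩ Icc a b).ncard =
      ((Finset.Ico m n).filter p).card := by
    rw [hset, ncard_coe_finset, Finset.card_image_of_injective _ (hammersleyPoint_injective N)]
    refine Finset.card_bij (fun i _ => (i : ℕ)) ?_ ?_ ?_
    · intro i hi
      simpa using hi
    · intro i _ j _ h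
      exact Fin.ext h
    · intro i hi
      rw [Finset.mem_filter] at hi
      exact ⟨⟨i, (Finset.mem_Ico.1 hi.1).2.trans_le hnN⟩, by simpa using hi, rfl⟩
  have hcount : (((Finset.Ico m n).filter p).card : ℝ) = Nat.count p n - Nat.count p m := by
    rw [eq_sub_iff_add_eq', Nat.count_eq_card_filter_range, Nat.count_eq_card_filter_range]
    simp only [Finset.card_filter]
    exact_mod_cast Finset.sum_range_add_sum_Ico (fun i => if p i then 1 else 0) hmn
  have hsplit : ∀ k, (Nat.count p k : ℝ) = Nat.count (fun i => radicalInverse i ≤ b.2) k -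
      Nat.count (fun i => radicalInverse i < a.2) k := by
    intro k
    rw [eq_sub_iff_add_eq]
    norm_cast
    simp only [Nat.count_eq_card_filter_range]
    rw [← Finset.card_union_of_disjoint]
    · congr 1
      ext i
      simp only [Finset.mem_union, Finset.mem_filter, hp]
      constructor
      · rintro (⟨h1, h2, h3⟩ | ⟨h1, h2⟩)
        · exact ⟨h1, h3⟩
        · exact ⟨h1, h2.le.trans hab2⟩
      · rintro ⟨h1, h2⟩
        rcases le_or_gt (a.2 : ℝ) (radicalInverse i) with h | h
        · exact .inl ⟨h1, h, h2⟩
        · exact .inr ⟨h1, h⟩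
    · rw [Finset.disjoint_filter]
      exact fun i _ h1 h2 => h2.not_ge h1.1
  have e1 := abs_count_radicalInverse_sub_le (fun r β => r ≤ β) (fun _ _ h => h.le)
    (fun _ _ h => h.not_ge) (fun e r β => by constructor <;> intro h <;> linarith) s m n b.2 hmn
    b.2.2.1 b.2.2.2
  have e2 := abs_count_radicalInverse_sub_le (fun r β => r < β) (fun _ _ h => h)
    (fun _ _ h => h.not_gt) (fun e r β => by constructor <;> intro h <;> linarith) s m n a.2 hmn
    a.2.2.1 a.2.2.2
  have e3 : ((n : ℝ) - m) / 2 ^ s ≤ 1 := by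
    rw [div_le_one (by positivity)]
    have h1 : (n : ℝ) ≤ N := by exact_mod_cast hnN
    have h2 : (N : ℝ) ≤ 2 ^ s := by exact_mod_cast hs
    have h3 : (0 : ℝ) ≤ m := by positivity
    linarith
  have e4 : |((n : ℝ) - m) - N * ((b.1 : ℝ) - a.1)| ≤ 1 := by
    have h1 : (N : ℝ) * a.1 ≤ m := Nat.le_ceil _
    have h2 : (m : ℝ) < N * a.1 + 1 := Nat.ceil_lt_add_one (by positivity)
    have h3 : (N : ℝ) * b.1 ≤ n := by
      rw [hn]
      rcases min_choice N (⌊(N : ℝ) * b.1⌋₊ + 1) with h | h <;> rw [h]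
      · nlinarith
      · push_cast
        exact (Nat.lt_floor_add_one ((N : ℝ) * b.1)).le
    have h4 : (n : ℝ) ≤ N * b.1 + 1 := by
      have : (n : ℝ) ≤ (⌊(N : ℝ) * b.1⌋₊ + 1 : ℕ) := by exact_mod_cast min_le_right _ _
      have h5 := Nat.floor_le (a := (N : ℝ) * b.1) (by positivity)
      push_cast at this
      linarith
    rw [abs_le]
    constructor <;> linarith
  have e5 : |(((n : ℝ) - m) - N * ((b.1 : ℝ) - a.1)) * ((b.2 : ℝ) - a.2)| ≤ 1 := by
    rw [abs_mul]
    refine mul_le_one₀ e4 (abs_nonneg _) ?_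
    rw [abs_le]
    constructor <;> linarith [a.2.2.1, a.2.2.2, b.2.2.1, b.2.2.2]
  rw [hcard, hcount, hsplit, hsplit]
  rw [abs_le] at e1 e2 e5 ⊢
  constructor <;> linarith

theorem discrepancy_hammersley_le :
    ∃ C : ℝ, ∀ N : ℕ, 2 ≤ N →
      discrepancy volume axisRectangles (hammersley N) ≤ C * (Real.log N / N) := by
  refine ⟨7 / Real.log 2, fun N hN => ?_⟩
  have hN' : (0 : ℝ) < N := by positivity
  have hl2 : 0 < Real.log 2 := Real.log_pos one_lt_two
  have hlog : 1 ≤ Real.log N / Real.log 2 := by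
    rw [one_le_div hl2]
    exact Real.log_le_log two_pos (by exact_mod_cast hN)
  have hs : (Nat.clog 2 N : ℝ) ≤ Real.log N / Real.log 2 + 1 := by
    have h1 : 2 ^ (Nat.clog 2 N - 1) < N := Nat.pow_pred_clog_lt_self one_lt_two (by omega)
    have h2 : 1 ≤ Nat.clog 2 N := Nat.clog_pos one_lt_two hN
    have h3 : Real.log ((2 : ℝ) ^ (Nat.clog 2 N - 1)) ≤ Real.log N :=
      Real.log_le_log (by positivity) (by exact_mod_cast h1.le)
    rw [Real.log_pow, Nat.cast_sub h2] at h3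
    rw [← sub_le_iff_le_add, le_div_iff₀ hl2]
    simpa using h3
  refine csSup_le ?_ ?_
  · exact Set.Nonempty.image _ ⟨Icc (0, 0) (1, 1), (0, 0), (1, 1), ⟨zero_le_one, zero_le_one⟩, rfl⟩
  rintro _ ⟨_, ⟨a, b, hab, rfl⟩, rfl⟩
  have key := abs_ncard_hammersley_inter_sub_le (by omega) (Nat.le_pow_clog one_lt_two N) hab
  simp only [card_hammersley, probReal_univ, div_one, volume_real_Icc_unitSquare hab]
  set c : ℝ := (((hammersley N : Set (I × I)) ∩ Icc a b).ncard : ℝ)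
  rw [show c / N - ((b.1 : ℝ) - a.1) * ((b.2 : ℝ) - a.2) =
    (c - N * (((b.1 : ℝ) - a.1) * ((b.2 : ℝ) - a.2))) / N by field_simp, abs_div,
    abs_of_pos hN', ← mul_div_assoc]
  gcongr
  calc _ ≤ 2 * (Nat.clog 2 N : ℝ) + 3 := key
    _ ≤ 7 * (Real.log N / Real.log 2) := by linarith
    _ = _ := by ring

/-! ### The Lambert map preserves area -/

/-- The Lambert map with values in `ℝ³`, on the whole plane. -/
def lambertVec (q : ℝ × ℝ) : Fin 3 → ℝ :=
  ![2 * √(q.2 - q.2 ^ 2) * Real.cos (2 * Real.pi * q.1),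
    2 * √(q.2 - q.2 ^ 2) * Real.sin (2 * Real.pi * q.1),
    1 - 2 * q.2]

theorem coe_lambert (p : I × I) :
    (lambert p : EuclideanSpace ℝ (Fin 3)) = WithLp.toLp 2 (lambertVec (p.1, p.2)) := rfl

theorem continuous_lambertVec : Continuous lambertVec := by
  unfold lambertVec
  refine continuous_pi fun i => ?_
  fin_cases i <;> simp <;> fun_prop

theorem continuous_lambert : Continuous lambert := by
  refine Continuous.subtype_mk ?_ _
  exact (PiLp.continuous_toLp 2 _).comp
    (continuous_lambertVec.comp (by fun_prop : Continuous fun p : I × I => ((p.1 : ℝ), (p.2 : ℝ))))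

theorem sum_sq_lambertVec {q : ℝ × ℝ} (h0 : 0 ≤ q.2) (h1 : q.2 ≤ 1) :
    lambertVec q 0 ^ 2 + lambertVec q 1 ^ 2 + lambertVec q 2 ^ 2 = 1 := by
  have hs := Real.sq_sqrt (show 0 ≤ q.2 - q.2 ^ 2 by nlinarith)
  have ht := Real.sin_sq_add_cos_sq (2 * Real.pi * q.1)
  simp only [lambertVec, Matrix.cons_val]
  rw [mul_pow, mul_pow, mul_pow, mul_pow, hs]
  linear_combination (4 * (q.2 - q.2 ^ 2)) * ht

theorem angle_eq_of_cos_eq_of_sin_eq {x x' : ℝ} (h : x ∈ Ico (0 : ℝ) 1) (h' : x' ∈ Ico (0 : ℝ) 1)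
    (hc : Real.cos (2 * Real.pi * x) = Real.cos (2 * Real.pi * x'))
    (hs : Real.sin (2 * Real.pi * x) = Real.sin (2 * Real.pi * x')) : x = x' := by
  have hpi := Real.pi_pos
  have h1 : Real.cos (2 * Real.pi * x - 2 * Real.pi * x') = 1 := by
    rw [Real.cos_sub, hc, hs]
    linear_combination Real.sin_sq_add_cos_sq (2 * Real.pi * x')
  have h2 := (Real.cos_eq_one_iff_of_lt_of_lt (by nlinarith [h.1, h.2, h'.1, h'.2])
    (by nlinarith [h.1, h.2, h'.1, h'.2])).1 h1
  nlinarith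

theorem lambertVec_injOn : InjOn lambertVec (Ico 0 1 ×ˢ Ioo 0 1) := by
  rintro ⟨x, y⟩ ⟨hx, hy⟩ ⟨x', y'⟩ ⟨hx', hy'⟩ h
  have h0 := congrFun h 0
  have h1 := congrFun h 1
  have h2 := congrFun h 2
  simp only [lambertVec, Matrix.cons_val] at h0 h1 h2 hx hy hx' hy'
  obtain rfl : y = y' := by linarith
  have hpos : 0 < √(y - y ^ 2) := Real.sqrt_pos.2 (by nlinarith [hy.1, hy.2])
  rw [angle_eq_of_cos_eq_of_sin_eq hx hx' (mul_left_cancel₀ (by positivity) h0)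
    (mul_left_cancel₀ (by positivity) h1)]

/-- Every unit vector off the plane `{v | v 1 = 0}` is in the image of the open square. -/
theorem exists_lambertVec_eq {v : Fin 3 → ℝ} (hv : v 0 ^ 2 + v 1 ^ 2 + v 2 ^ 2 = 1)
    (h1 : v 1 ≠ 0) : ∃ q ∈ Ioo (0 : ℝ) 1 ×ˢ Ioo (0 : ℝ) 1, lambertVec q = v := by
  have hpi := Real.pi_pos
  have h1sq : 0 < v 1 ^ 2 := by positivity
  have hlt : v 2 ^ 2 < 1 := by nlinarith [sq_nonneg (v 0)]
  have hv2 : -1 < v 2 ∧ v 2 < 1 := abs_lt.1 ((sq_lt_one_iff_abs_lt_one _).1 hlt)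
  set z : ℂ := ⟨v 0, v 1⟩ with hz
  have hnorm : ‖z‖ = 2 * √((1 - v 2) / 2 - ((1 - v 2) / 2) ^ 2) := by
    rw [Complex.norm_eq_sqrt_sq_add_sq]
    rw [show v 0 ^ 2 + v 1 ^ 2 = 2 ^ 2 * ((1 - v 2) / 2 - ((1 - v 2) / 2) ^ 2) by
      linear_combination hv, Real.sqrt_mul (by positivity), Real.sqrt_sq (by positivity)]
  have hre : ‖z‖ * Real.cos z.arg = v 0 := Complex.norm_mul_cos_arg z
  have him : ‖z‖ * Real.sin z.arg = v 1 := Complex.norm_mul_sin_arg z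
  have harg : z.arg ≠ 0 := by
    intro h
    rw [h] at him
    simp at him
    exact h1 him.symm
  obtain ⟨θ, hθ0, hθ1, hc, hs⟩ : ∃ θ : ℝ, 0 < θ ∧ θ < 2 * Real.pi ∧
      Real.cos θ = Real.cos z.arg ∧ Real.sin θ = Real.sin z.arg := by
    rcases lt_or_gt_of_ne harg with h | h
    · exact ⟨z.arg + 2 * Real.pi, by linarith [Complex.neg_pi_lt_arg z], by linarith,
        Real.cos_add_two_pi _, Real.sin_add_two_pi _⟩
    · exact ⟨z.arg, h, by linarith [Complex.arg_le_pi z], rfl, rfl⟩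
  refine ⟨(θ / (2 * Real.pi), (1 - v 2) / 2), ⟨⟨by positivity, ?_⟩, ?_, ?_⟩, ?_⟩
  · rw [div_lt_one (by positivity)]; exact hθ1
  · show 0 < (1 - v 2) / 2
    linarith
  · show (1 - v 2) / 2 < 1
    linarith
  · funext i
    have : 2 * Real.pi * (θ / (2 * Real.pi)) = θ := by field_simp
    fin_cases i <;> simp only [lambertVec, this, ← hnorm, hc, hs]
    · exact hre
    · exact him
    · simp; ring

/-- Spherical coordinates adapted to the Lambert map: `(r, x, y) ↦ r • lambertVec (x, y)`. -/
def lambertCone (p : Fin 3 → ℝ) : Fin 3 → ℝ := p 0 • lambertVec (p 1, p 2)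

/-- The Jacobian matrix of `lambertCone`. -/
def lambertConeJacobian (p : Fin 3 → ℝ) : Matrix (Fin 3) (Fin 3) ℝ :=
  let ρ := 2 * √(p 2 - p 2 ^ 2)
  let c := Real.cos (2 * Real.pi * p 1)
  let s := Real.sin (2 * Real.pi * p 1)
  let ρ' := 2 * (1 - 2 * p 2) / ρ
  !![ρ * c, p 0 * (ρ * (-s * (2 * Real.pi))), p 0 * (ρ' * c);
     ρ * s, p 0 * (ρ * (c * (2 * Real.pi))), p 0 * (ρ' * s);
     1 - 2 * p 2, 0, p 0 * (-2)]

theorem hasFDerivAt_lambertCone {p : Fin 3 → ℝ} (h0 : 0 < p 2) (h1 : p 2 < 1) :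
    HasFDerivAt lambertCone (LinearMap.toContinuousLinearMap
      (Matrix.toLin' (lambertConeJacobian p))) p := by
  have hpos : 0 < p 2 - p 2 ^ 2 := by nlinarith
  have hsq : 0 < √(p 2 - p 2 ^ 2) := Real.sqrt_pos.2 hpos
  have hp : ∀ i : Fin 3, HasFDerivAt (fun q : Fin 3 → ℝ => q i)
    (ContinuousLinearMap.proj (R := ℝ) (φ := fun _ : Fin 3 => ℝ) i) p := fun i =>
    (ContinuousLinearMap.proj (R := ℝ) (φ := fun _ : Fin 3 => ℝ) i).hasFDerivAt
  have hρ := ((((hp 2).sub ((hp 2).pow 2)).sqrt hpos.ne').const_mul 2)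
  have hc := ((hp 1).const_mul (2 * Real.pi)).cos
  have hs := ((hp 1).const_mul (2 * Real.pi)).sin
  rw [hasFDerivAt_pi']
  intro i
  fin_cases i
  · refine ((hp 0).mul (hρ.mul hc)).congr_fderiv ?_
    ext v
    simp [lambertConeJacobian, Matrix.toLin'_apply, dotProduct, Fin.sum_univ_three]
    field_simp
    ring
  · refine ((hp 0).mul (hρ.mul hs)).congr_fderiv ?_
    ext v
    simp [lambertConeJacobian, Matrix.toLin'_apply, dotProduct, Fin.sum_univ_three]
    field_simp
    ring
  · refine ((hp 0).mul (((hp 2).const_mul 2).const_sub 1)).congr_fderiv ?_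
    ext v
    simp [lambertConeJacobian, Matrix.toLin'_apply, dotProduct, Fin.sum_univ_three]
    ring

theorem det_lambertConeJacobian {p : Fin 3 → ℝ} (h0 : 0 < p 2) (h1 : p 2 < 1) :
    (lambertConeJacobian p).det = -(4 * Real.pi * p 0 ^ 2) := by
  have hpos : 0 < p 2 - p 2 ^ 2 := by nlinarith
  have hsq : 0 < √(p 2 - p 2 ^ 2) := Real.sqrt_pos.2 hpos
  have hs := Real.sq_sqrt hpos.le
  have ht := Real.sin_sq_add_cos_sq (2 * Real.pi * p 1)
  rw [Matrix.det_fin_three]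
  simp only [lambertConeJacobian, Matrix.of_apply, Matrix.cons_val]
  set R := √(p 2 - p 2 ^ 2)
  set c := Real.cos (2 * Real.pi * p 1)
  set s := Real.sin (2 * Real.pi * p 1)
  have e : 2 * (1 - 2 * p 2) / (2 * R) * R = 1 - 2 * p 2 := by field_simp
  set k := 2 * (1 - 2 * p 2) / (2 * R)
  have e2 : (1 - 2 * p 2) ^ 2 = 1 - 4 * R ^ 2 := by rw [hs]; ring
  have hc : c ^ 2 = 1 - s ^ 2 := by linarith
  linear_combination (-4 * Real.pi * p 0 ^ 2 * (1 - 2 * p 2) * (s ^ 2 + c ^ 2)) * e +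
    (-4 * Real.pi * p 0 ^ 2 * (s ^ 2 + c ^ 2)) * e2 - 4 * Real.pi * p 0 ^ 2 * ht

open scoped Pointwise ENNReal

/-- The part of the open unit box over a set `T` in the plane of the last two coordinates. -/
def boxOver (T : Set (ℝ × ℝ)) : Set (Fin 3 → ℝ) := {p | p 0 ∈ Ioo (0 : ℝ) 1 ∧ (p 1, p 2) ∈ T}

theorem measurableSet_boxOver {T : Set (ℝ × ℝ)} (hT : MeasurableSet T) :
    MeasurableSet (boxOver T) :=
  ((measurable_pi_apply 0) measurableSet_Ioo).inter
    (((measurable_pi_apply 1).prodMk (measurable_pi_apply 2)) hT)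

theorem lambertCone_injOn {T : Set (ℝ × ℝ)} (hT : T ⊆ Ioo 0 1 ×ˢ Ioo 0 1) :
    InjOn lambertCone (boxOver T) := by
  rintro p ⟨hp, hpT⟩ q ⟨hq, hqT⟩ h
  have hp' := hT hpT
  have hq' := hT hqT
  have hsp := sum_sq_lambertVec (q := (p 1, p 2)) hp'.2.1.le hp'.2.2.le
  have hsq := sum_sq_lambertVec (q := (q 1, q 2)) hq'.2.1.le hq'.2.2.le
  have e : ∀ i, p 0 * lambertVec (p 1, p 2) i = q 0 * lambertVec (q 1, q 2) i :=
    fun i => congrFun h i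
  have h0 : p 0 ^ 2 = q 0 ^ 2 := by
    have e0 := congrArg (· ^ 2) (e 0)
    have e1 := congrArg (· ^ 2) (e 1)
    have e2 := congrArg (· ^ 2) (e 2)
    simp only [mul_pow] at e0 e1 e2
    linear_combination e0 + e1 + e2 - p 0 ^ 2 * hsp + q 0 ^ 2 * hsq
  have h00 : p 0 = q 0 := (pow_left_inj₀ hp.1.le hq.1.le two_ne_zero).1 h0
  have hv : lambertVec (p 1, p 2) = lambertVec (q 1, q 2) := by
    funext i
    have := e i
    rw [h00] at this
    exact mul_left_cancel₀ hq.1.ne' this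
  have h12 := lambertVec_injOn (prod_mono Ioo_subset_Ico_self le_rfl hp')
    (prod_mono Ioo_subset_Ico_self le_rfl hq') hv
  rw [Prod.mk.injEq] at h12
  funext i
  fin_cases i
  exacts [h00, h12.1, h12.2]

theorem setLIntegral_boxOver (T : Set (ℝ × ℝ)) (hT : MeasurableSet T) (g : ℝ → ℝ≥0∞)
    (hg : Measurable g) :
    ∫⁻ p in boxOver T, g (p 0) = (∫⁻ r in Ioo (0 : ℝ) 1, g r) * volume T := by
  have e1 := volume_preserving_piFinSuccAbove (fun _ : Fin 3 => ℝ) 0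
  have e2 := (MeasurePreserving.id (volume : Measure ℝ)).prod (volume_preserving_finTwoArrow ℝ)
  have e := e2.comp e1
  have hpre : boxOver T = (Prod.map id (MeasurableEquiv.finTwoArrow (α := ℝ)) ∘
      MeasurableEquiv.piFinSuccAbove (fun _ : Fin 3 => ℝ) 0) ⁻¹' (Ioo (0 : ℝ) 1 ×ˢ T) := by
    ext p
    rfl
  have hf : (fun p : Fin 3 → ℝ => g (p 0)) = (fun x : ℝ × (ℝ × ℝ) => g x.1) ∘
      (Prod.map id (MeasurableEquiv.finTwoArrow (α := ℝ)) ∘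
      MeasurableEquiv.piFinSuccAbove (fun _ : Fin 3 => ℝ) 0) := by
    funext p
    rfl
  rw [hpre, hf]
  have := e.setLIntegral_comp_preimage ((measurableSet_Ioo (a := (0 : ℝ)) (b := 1)).prod hT)
    (f := fun x : ℝ × (ℝ × ℝ) => g x.1) (hg.comp measurable_fst)
  refine Eq.trans this ?_
  rw [← Measure.prod_restrict,
    lintegral_prod (fun x : ℝ × (ℝ × ℝ) => g x.1) (hg.comp measurable_fst).aemeasurable]
  simp [lintegral_mul_const _ hg]

/-- The radial factor in the volume of a cone over a piece of the sphere. -/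
def coneFactor : ℝ≥0∞ := ∫⁻ r in Ioo (0 : ℝ) 1, ENNReal.ofReal (4 * Real.pi * r ^ 2)

theorem volume_image_lambertCone {T : Set (ℝ × ℝ)} (hT : MeasurableSet T)
    (hsub : T ⊆ Ioo 0 1 ×ˢ Ioo 0 1) :
    volume (lambertCone '' boxOver T) = coneFactor * volume T := by
  have h := lintegral_abs_det_fderiv_eq_addHaar_image volume (measurableSet_boxOver hT)
    (f' := fun p => LinearMap.toContinuousLinearMap (Matrix.toLin' (lambertConeJacobian p)))
    (fun p hp => (hasFDerivAt_lambertCone (hsub hp.2).2.1 (hsub hp.2).2.2).hasFDerivWithinAt)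
    (lambertCone_injOn hsub)
  rw [← h, coneFactor, ← setLIntegral_boxOver T hT _ (by fun_prop)]
  refine setLIntegral_congr_fun (measurableSet_boxOver hT) fun p hp => ?_
  have : (LinearMap.toContinuousLinearMap (Matrix.toLin' (lambertConeJacobian p))).det =
      (lambertConeJacobian p).det := by
    rw [ContinuousLinearMap.det, LinearMap.coe_toContinuousLinearMap, LinearMap.det_toLin']
  simp only [this, det_lambertConeJacobian (hsub hp.2).2.1 (hsub hp.2).2.2, abs_neg]
  rw [abs_of_nonneg (by positivity)]

/-- The part of the open unit square that the Lambert map sends into `X`. -/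
def openPreimage (X : Set Sphere2) : Set (ℝ × ℝ) :=
  (Ioo 0 1 ×ˢ Ioo 0 1) ∩
    (fun q => WithLp.toLp 2 (lambertVec q)) ⁻¹' ((↑) '' X : Set (EuclideanSpace ℝ (Fin 3)))

theorem measurable_toLp_lambertVec :
    Measurable fun q => (WithLp.toLp 2 (lambertVec q) : EuclideanSpace ℝ (Fin 3)) :=
  ((PiLp.continuous_toLp 2 _).comp continuous_lambertVec).measurable

theorem measurableSet_coe_image {X : Set Sphere2} (hX : MeasurableSet X) :
    MeasurableSet ((↑) '' X : Set (EuclideanSpace ℝ (Fin 3))) :=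
  (MeasurableEmbedding.subtype_coe Metric.isClosed_sphere.measurableSet).measurableSet_image.2 hX

theorem measurableSet_openPreimage {X : Set Sphere2} (hX : MeasurableSet X) :
    MeasurableSet (openPreimage X) :=
  (measurableSet_Ioo.prod measurableSet_Ioo).inter
    (measurable_toLp_lambertVec (measurableSet_coe_image hX))

/-- Up to the half-plane of longitude zero, the cone over `X` is the image of the box over the
planar preimage of `X`. -/
theorem volume_cone {X : Set Sphere2} :
    volume (Ioo (0 : ℝ) 1 • ((↑) '' X : Set (EuclideanSpace ℝ (Fin 3)))) =
      volume (lambertCone '' boxOver (openPreimage X)) := by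
  rw [← (EuclideanSpace.volume_preserving_symm_measurableEquiv_toLp (Fin 3)).symm.measure_preimage_equiv]
  set A : Set (Fin 3 → ℝ) := _ ⁻¹' (Ioo (0 : ℝ) 1 • ((↑) '' X : Set (EuclideanSpace ℝ (Fin 3))))
    with hA
  have hmem : ∀ v : Fin 3 → ℝ, v ∈ A ↔ ∃ r ∈ Ioo (0 : ℝ) 1, ∃ z ∈ X,
      r • (z : EuclideanSpace ℝ (Fin 3)) = WithLp.toLp 2 v := by
    intro v
    rw [hA, mem_preimage, mem_smul]
    constructor
    · rintro ⟨r, hr, _, ⟨z, hz, rfl⟩, h⟩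
      exact ⟨r, hr, z, hz, h⟩
    · rintro ⟨r, hr, z, hz, h⟩
      exact ⟨r, hr, _, ⟨z, hz, rfl⟩, h⟩
  have hnull : volume {v : Fin 3 → ℝ | v 1 = 0} = 0 := Measure.pi_hyperplane _ 1 0
  refine le_antisymm ?_ (measure_mono ?_)
  · calc volume A ≤ volume (lambertCone '' boxOver (openPreimage X) ∪ {v | v 1 = 0}) := by
          refine measure_mono fun v hv => ?_
          by_cases h1 : v 1 = 0
          · exact .inr h1
          left
          obtain ⟨r, hr, z, hz, h⟩ := (hmem v).1 hv
          have hzv : ∀ i, r * (z : EuclideanSpace ℝ (Fin 3)) i = v i := fun i =>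
            congrArg (fun w : EuclideanSpace ℝ (Fin 3) => w i) h
          have hsum : (z : EuclideanSpace ℝ (Fin 3)) 0 ^ 2 + (z : EuclideanSpace ℝ (Fin 3)) 1 ^ 2 +
              (z : EuclideanSpace ℝ (Fin 3)) 2 ^ 2 = 1 := by
            have := EuclideanSpace.norm_sq_eq (z : EuclideanSpace ℝ (Fin 3))
            rw [norm_eq_of_mem_sphere z] at this
            simp [Fin.sum_univ_three] at this
            exact this.symm
          obtain ⟨q, hq, hqz⟩ := exists_lambertVec_eq hsum (by
            intro h0
            exact h1 (by rw [← hzv 1, h0, mul_zero]))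
          have hqz' : WithLp.toLp 2 (lambertVec q) = (z : EuclideanSpace ℝ (Fin 3)) := by
            rw [hqz]
          refine ⟨![r, q.1, q.2], ⟨hr, hq, ?_⟩, ?_⟩
          · exact ⟨z, hz, hqz'.symm⟩
          · funext i
            rw [← hzv i]
            exact congrArg (r * ·) (congrFun hqz i)
      _ ≤ volume (lambertCone '' boxOver (openPreimage X)) + volume {v : Fin 3 → ℝ | v 1 = 0} :=
          measure_union_le _ _
      _ = _ := by rw [hnull, add_zero]
  · rintro _ ⟨p, ⟨hp, hq, z, hz, h⟩, rfl⟩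
    refine (hmem _).2 ⟨p 0, hp, z, hz, ?_⟩
    rw [h]
    rfl

theorem volume_lambert_preimage {X : Set Sphere2} (hX : MeasurableSet X) :
    volume (lambert ⁻¹' X) = volume (openPreimage X) := by
  set T : Set (ℝ × ℝ) := (fun q => WithLp.toLp 2 (lambertVec q)) ⁻¹'
    ((↑) '' X : Set (EuclideanSpace ℝ (Fin 3))) with hT
  have hTm : MeasurableSet T := measurable_toLp_lambertVec (measurableSet_coe_image hX)
  have hval : MeasurePreserving ((↑) : I → ℝ) volume (volume.restrict I) :=
    measurePreserving_subtype_coe measurableSet_Icc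
  have h := (hval.prod hval).measure_preimage hTm.nullMeasurableSet
  have hpre : lambert ⁻¹' X = Prod.map ((↑) : I → ℝ) ((↑) : I → ℝ) ⁻¹' T := by
    ext p
    rw [mem_preimage, mem_preimage, hT, mem_preimage]
    constructor
    · intro hp
      exact ⟨_, hp, rfl⟩
    · rintro ⟨z, hz, hzp⟩
      have : lambert p = z := Subtype.ext hzp.symm
      rwa [this]
  rw [hpre]
  refine Eq.trans h ?_
  have hI : (volume.restrict I : Measure ℝ) = volume.restrict (Ioo 0 1) :=
    (Measure.restrict_congr_set Ioo_ae_eq_Icc).symm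
  rw [hI, Measure.prod_restrict, Measure.restrict_apply hTm, inter_comm]
  rfl

theorem surfaceMeasure_eq {X : Set Sphere2} (hX : MeasurableSet X) :
    surfaceMeasure X = 3 * coneFactor * volume (lambert ⁻¹' X) := by
  rw [surfaceMeasure, Measure.toSphere_apply' _ hX, volume_cone,
    volume_image_lambertCone (measurableSet_openPreimage hX) inter_subset_left,
    volume_lambert_preimage hX, mul_assoc]
  simp

instance : IsFiniteMeasure surfaceMeasure := by
  unfold surfaceMeasure
  infer_instance

/-- The Lambert map preserves the relative area. -/
theorem surfaceMeasure_div {X : Set Sphere2} (hX : MeasurableSet X) :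
    surfaceMeasure.real X / surfaceMeasure.real univ =
      (volume : Measure (I × I)).real (lambert ⁻¹' X) := by
  have huniv : surfaceMeasure univ = 3 * coneFactor := by
    rw [surfaceMeasure_eq MeasurableSet.univ]
    simp
  have hne : surfaceMeasure univ ≠ 0 := by
    rw [Ne, Measure.measure_univ_eq_zero, surfaceMeasure]
    exact Measure.toSphere_ne_zero _
  have hr : surfaceMeasure.real univ ≠ 0 := by
    rw [measureReal_def, ENNReal.toReal_ne_zero]
    exact ⟨hne, measure_ne_top _ _⟩
  rw [div_eq_iff hr, measureReal_def, surfaceMeasure_eq hX, ← huniv, ENNReal.toReal_mul, mul_comm]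
  rfl

/-! ### Functions of bounded variation from quasi-concavity -/

/-- The function `h` has variation at most `C` on `[a, b]`, in the form of a potential `Φ` whose
increments dominate those of `h`. -/
def HasVariationLE (h : ℝ → ℝ) (a b C : ℝ) : Prop :=
  ∃ Φ : ℝ → ℝ, (∀ x y, a ≤ x → x ≤ y → y ≤ b → |h x - h y| ≤ Φ y - Φ x) ∧ Φ b - Φ a ≤ C

theorem HasVariationLE.trans {h : ℝ → ℝ} {a b c C C' : ℝ} (hab : a ≤ b) (hbc : b ≤ c)
    (h₁ : HasVariationLE h a b C) (h₂ : HasVariationLE h b c C') :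
    HasVariationLE h a c (C + C') := by
  obtain ⟨Φ, hΦ, hC⟩ := h₁
  obtain ⟨Ψ, hΨ, hC'⟩ := h₂
  refine ⟨fun x => if x ≤ b then Φ x else Φ b + (Ψ x - Ψ b), fun x y hx hxy hy => ?_, ?_⟩
  · by_cases h1 : y ≤ b
    · simpa [h1, hxy.trans h1] using hΦ x y hx hxy h1
    · have h1' := (not_le.1 h1).le
      by_cases h2 : x ≤ b
      · simp only [h1, h2, if_true, if_false]
        have e1 := hΦ x b hx h2 le_rfl
        have e2 := hΨ b y le_rfl h1' hy
        have e3 := abs_sub_le (h x) (h b) (h y)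
        linarith
      · simp only [h1, h2, if_false]
        have := hΨ x y (not_le.1 h2).le hxy hy
        linarith
  · simp only [hab, if_true]
    split_ifs with h1
    · obtain rfl : b = c := le_antisymm hbc h1
      have := (abs_nonneg _).trans (hΨ b b le_rfl le_rfl le_rfl)
      have := hΨ b b le_rfl le_rfl le_rfl
      have h0 : 0 ≤ C' := by simpa using hC'
      linarith
    · linarith

theorem HasVariationLE.neg {h : ℝ → ℝ} {a b C : ℝ} (hh : HasVariationLE h a b C) :
    HasVariationLE (fun x => -h x) a b C := by
  obtain ⟨Φ, hΦ, hC⟩ := hh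
  refine ⟨Φ, fun x y hx hxy hy => ?_, hC⟩
  have := hΦ x y hx hxy hy
  rwa [← abs_neg, neg_sub, sub_neg_eq_add, neg_add_eq_sub]

open Classical in
/-- Let `q` be quasi-concave, and let `h` be bounded by one and increase with `q` up to the
increments of a monotone function `t`, bounded by one too. Then `h` has bounded variation:
`q` is monotone on the set of points left of a larger value of `q`, and antitone on
the complement, so `h + 2 t` and `-h + 2 t` are suitable potentials there. -/
theorem hasVariationLE_of_quasiconcave {a b : ℝ} {t q h : ℝ → ℝ} (hab : a ≤ b)
    (ht : MonotoneOn t (Icc a b)) (ht1 : ∀ x ∈ Icc a b, |t x| ≤ 1)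
    (hh1 : ∀ x ∈ Icc a b, |h x| ≤ 1)
    (hqh : ∀ x ∈ Icc a b, ∀ y ∈ Icc a b, q x ≤ q y → h x ≤ h y + |t x - t y|)
    (hq : ∀ x ∈ Icc a b, ∀ y ∈ Icc a b, ∀ z ∈ Icc a b, x < y → y < z → min (q x) (q z) ≤ q y) :
    HasVariationLE h a b 10 := by
  set s : Set ℝ := {x | ∃ y ∈ Icc a b, x < y ∧ q x < q y} with hs
  have hs1 : ∀ x ∈ Icc a b, ∀ y ∈ Icc a b, x ≤ y → y ∈ s → q x ≤ q y := by
    rintro x hx y hy hxy ⟨z, hz, hyz, hqyz⟩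
    rcases hxy.eq_or_lt with rfl | hxy
    · exact le_rfl
    rcases min_le_iff.1 (hq x hx y hy z hz hxy hyz) with h' | h'
    · exact h'
    · exact absurd h' hqyz.not_ge
  have hdown : ∀ x ∈ Icc a b, ∀ y ∈ Icc a b, x ≤ y → y ∈ s → x ∈ s := by
    intro x hx y hy hxy hys
    have := hs1 x hx y hy hxy hys
    obtain ⟨z, hz, hyz, hqyz⟩ := hys
    exact ⟨z, hz, hxy.trans_lt hyz, this.trans_lt hqyz⟩
  have hs2 : ∀ x ∈ Icc a b, ∀ y ∈ Icc a b, x ≤ y → x ∉ s → q y ≤ q x := by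
    intro x hx y hy hxy hxs
    rcases hxy.eq_or_lt with rfl | hxy
    · exact le_rfl
    by_contra hlt
    exact hxs ⟨y, hy, hxy, not_le.1 hlt⟩
  -- the constant 4 covers the jump of `h` where the two parts meet
  refine ⟨fun x => (if x ∈ s then h x else 4 - h x) + 2 * t x, fun x y hx hxy hy => ?_, ?_⟩
  · have hxI : x ∈ Icc a b := ⟨hx, hxy.trans hy⟩
    have hyI : y ∈ Icc a b := ⟨hx.trans hxy, hy⟩
    have htxy : t x ≤ t y := ht hxI hyI hxy
    have hhx := abs_le.1 (hh1 x hxI)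
    have hhy := abs_le.1 (hh1 y hyI)
    by_cases hys : y ∈ s
    · have hxs := hdown x hxI y hyI hxy hys
      have := hqh x hxI y hyI (hs1 x hxI y hyI hxy hys)
      rw [abs_sub_comm, abs_of_nonneg (sub_nonneg.2 htxy)] at this
      simp only [hxs, hys, if_true]
      rw [abs_le]
      constructor <;> linarith
    · by_cases hxs : x ∈ s
      · simp only [hxs, hys, if_true, if_false]
        rw [abs_le]
        constructor <;> linarith
      · have := hqh y hyI x hxI (hs2 x hxI y hyI hxy hxs)
        rw [abs_of_nonneg (sub_nonneg.2 htxy)] at this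
        simp only [hxs, hys, if_false]
        rw [abs_le]
        constructor <;> linarith
  · have ha := left_mem_Icc.2 hab
    have hb := right_mem_Icc.2 hab
    have h1 := abs_le.1 (hh1 a ha)
    have h2 := abs_le.1 (hh1 b hb)
    have h3 := abs_le.1 (ht1 a ha)
    have h4 := abs_le.1 (ht1 b hb)
    dsimp only
    split_ifs <;> linarith

/-! ### Heights on the sphere and on the gnomonic plane -/

/-- Let `t` be the tangent of a longitude and `z` a height on the unit sphere. The central
projection to the tangent plane at longitude and latitude zero gives the point of that
longitude and height `z` the ordinate `w = z √(1 + t²) / √(1 - z²)`; this is the sine of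
`arctan w`, which makes sense at the poles too. -/
def gnomonicHeight (t z : ℝ) : ℝ := z * √(1 + t ^ 2) / √(1 + t ^ 2 * z ^ 2)

theorem gnomonicHeight_neg (t z : ℝ) : gnomonicHeight t (-z) = -gnomonicHeight t z := by
  simp [gnomonicHeight, neg_div]

theorem gnomonicHeight_one (t : ℝ) : gnomonicHeight t 1 = 1 := by
  have : 0 < √(1 + t ^ 2) := by positivity
  simp [gnomonicHeight, this.ne']

theorem gnomonicHeight_neg_one (t : ℝ) : gnomonicHeight t (-1) = -1 := by
  rw [gnomonicHeight_neg, gnomonicHeight_one]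

/-- Monotonicity of an odd function follows from monotonicity on the nonnegative reals. -/
theorem le_of_odd {f : ℝ → ℝ} {S : Set ℝ} (hS : ∀ x ∈ S, -x ∈ S) (hodd : ∀ x, f (-x) = -f x)
    (hnonneg : ∀ x ∈ S, 0 ≤ x → 0 ≤ f x)
    (hmono : ∀ x ∈ S, ∀ y ∈ S, 0 ≤ x → x ≤ y → f x ≤ f y) {x y : ℝ} (hx : x ∈ S) (hy : y ∈ S)
    (hxy : x ≤ y) : f x ≤ f y := by
  rcases le_total 0 x with h0 | h0
  · exact hmono x hx y hy h0 hxy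
  · have h1 := hnonneg (-x) (hS x hx) (by linarith)
    rw [hodd] at h1
    rcases le_total 0 y with h2 | h2
    · linarith [hnonneg y hy h2]
    · have := hmono (-y) (hS y hy) (-x) (hS x hx) (by linarith) (by linarith)
      rw [hodd, hodd] at this
      linarith

theorem gnomonicHeight_mono (t : ℝ) {z z' : ℝ} (h : z ≤ z') :
    gnomonicHeight t z ≤ gnomonicHeight t z' := by
  refine le_of_odd (S := univ) (fun _ _ => mem_univ _) (gnomonicHeight_neg t) ?_ ?_
    (mem_univ z) (mem_univ z') h
  · intro x _ hx
    unfold gnomonicHeight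
    positivity
  · intro x _ y _ hx hxy
    unfold gnomonicHeight
    rw [div_le_div_iff₀ (by positivity) (by positivity)]
    have hy : 0 ≤ y := hx.trans hxy
    have : x * √(1 + t ^ 2 * y ^ 2) ≤ y * √(1 + t ^ 2 * x ^ 2) := by
      refine le_of_sq_le_sq ?_ (by positivity)
      rw [mul_pow, mul_pow, Real.sq_sqrt (by positivity), Real.sq_sqrt (by positivity)]
      nlinarith
    have h0 : 0 ≤ √(1 + t ^ 2) := Real.sqrt_nonneg _
    nlinarith

/-- The inverse of `gnomonicHeight t`. -/
def sphericalHeight (t q : ℝ) : ℝ := q / √(1 + t ^ 2 * (1 - q ^ 2))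

theorem one_sub_gnomonicHeight_sq (t z : ℝ) :
    1 - gnomonicHeight t z ^ 2 = (1 - z ^ 2) / (1 + t ^ 2 * z ^ 2) := by
  have h : 0 < 1 + t ^ 2 * z ^ 2 := by positivity
  rw [gnomonicHeight, div_pow, mul_pow, Real.sq_sqrt (by positivity), Real.sq_sqrt h.le]
  field_simp
  ring

theorem abs_gnomonicHeight_le (t : ℝ) {z : ℝ} (hz : |z| ≤ 1) : |gnomonicHeight t z| ≤ 1 := by
  rw [← sq_le_one_iff_abs_le_one] at hz ⊢
  have := one_sub_gnomonicHeight_sq t z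
  have h2 : 0 ≤ (1 - z ^ 2) / (1 + t ^ 2 * z ^ 2) := div_nonneg (by linarith) (by positivity)
  linarith

theorem sphericalHeight_gnomonicHeight (t z : ℝ) :
    sphericalHeight t (gnomonicHeight t z) = z := by
  have h : 0 < 1 + t ^ 2 * z ^ 2 := by positivity
  rw [sphericalHeight, one_sub_gnomonicHeight_sq,
    show 1 + t ^ 2 * ((1 - z ^ 2) / (1 + t ^ 2 * z ^ 2)) = (1 + t ^ 2) / (1 + t ^ 2 * z ^ 2) by
      field_simp; ring, Real.sqrt_div (by positivity), gnomonicHeight]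
  have h1 : 0 < √(1 + t ^ 2 * z ^ 2) := Real.sqrt_pos.2 h
  have h2 : 0 < √(1 + t ^ 2) := by positivity
  field_simp

theorem sphericalHeight_mono (t : ℝ) {q q' : ℝ} (hq : |q| ≤ 1) (hq' : |q'| ≤ 1) (h : q ≤ q') :
    sphericalHeight t q ≤ sphericalHeight t q' := by
  have hpos : ∀ x : ℝ, |x| ≤ 1 → 0 < √(1 + t ^ 2 * (1 - x ^ 2)) := by
    intro x hx
    have := (sq_le_one_iff_abs_le_one _).2 hx
    have := mul_nonneg (sq_nonneg t) (sub_nonneg.2 this)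
    positivity
  refine le_of_odd (f := sphericalHeight t) (S := {x | |x| ≤ 1}) (fun x hx => by simpa using hx)
    (fun x => by simp [sphericalHeight, neg_div]) ?_ ?_ hq hq' h
  · intro x _ h0
    unfold sphericalHeight
    positivity
  · intro x hx y hy h0 hxy
    unfold sphericalHeight
    refine div_le_div₀ (h0.trans hxy) hxy (hpos y hy) (Real.sqrt_le_sqrt ?_)
    have : x ^ 2 ≤ y ^ 2 := by gcongr
    nlinarith [sq_nonneg t]

theorem abs_sqrt_one_add_sq_sub_le (x y : ℝ) : |√(1 + x ^ 2) - √(1 + y ^ 2)| ≤ |x - y| := by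
  have hx : |x| ≤ √(1 + x ^ 2) := Real.abs_le_sqrt (by linarith)
  have hy : |y| ≤ √(1 + y ^ 2) := Real.abs_le_sqrt (by linarith)
  have hpos : 0 < √(1 + x ^ 2) + √(1 + y ^ 2) := by positivity
  have e : (√(1 + x ^ 2) - √(1 + y ^ 2)) * (√(1 + x ^ 2) + √(1 + y ^ 2)) = (x - y) * (x + y) := by
    have h1 := Real.sq_sqrt (show 0 ≤ 1 + x ^ 2 by positivity)
    have h2 := Real.sq_sqrt (show 0 ≤ 1 + y ^ 2 by positivity)
    linear_combination h1 - h2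
  have e' := congrArg abs e
  rw [abs_mul, abs_mul, abs_of_pos hpos] at e'
  have : |x + y| ≤ √(1 + x ^ 2) + √(1 + y ^ 2) := (abs_add_le x y).trans (add_le_add hx hy)
  refine le_of_mul_le_mul_right ?_ hpos
  rw [e']
  gcongr

theorem abs_sphericalHeight_sub_le {q : ℝ} (hq : |q| ≤ 1) (t t' : ℝ) :
    |sphericalHeight t q - sphericalHeight t' q| ≤ |t - t'| := by
  have hq2 := (sq_le_one_iff_abs_le_one _).2 hq
  set c := √(1 - q ^ 2) with hc
  have hcc : c ^ 2 = 1 - q ^ 2 := Real.sq_sqrt (by linarith)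
  have hc1 : c ≤ 1 := Real.sqrt_le_one.2 (by nlinarith)
  have hc0 : 0 ≤ c := Real.sqrt_nonneg _
  unfold sphericalHeight
  rw [← hcc, ← mul_pow, ← mul_pow]
  have h1 : 1 ≤ √(1 + (t * c) ^ 2) := Real.one_le_sqrt.2 (by nlinarith [sq_nonneg (t * c)])
  have h2 : 1 ≤ √(1 + (t' * c) ^ 2) := Real.one_le_sqrt.2 (by nlinarith [sq_nonneg (t' * c)])
  have h3 := abs_sqrt_one_add_sq_sub_le (t' * c) (t * c)
  set A := √(1 + (t * c) ^ 2)
  set B := √(1 + (t' * c) ^ 2)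
  have hAB : 1 ≤ A * B := one_le_mul_of_one_le_of_one_le h1 h2
  rw [show q / A - q / B = q * (B - A) / (A * B) by field_simp, abs_div, abs_mul,
    abs_of_pos (by linarith : 0 < A * B)]
  calc |q| * |B - A| / (A * B) ≤ |q| * |B - A| := div_le_self (by positivity) hAB
    _ ≤ 1 * |t' * c - t * c| := by gcongr
    _ = |t - t'| * c := by rw [one_mul, ← sub_mul, abs_mul, abs_of_nonneg hc0, abs_sub_comm]
    _ ≤ |t - t'| := mul_le_of_le_one_right (abs_nonneg _) hc1

/-- Ordering by gnomonic height agrees with ordering by height, up to the difference of the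
tangents. -/
theorem le_add_of_gnomonicHeight_le {t t' z z' : ℝ} (hz : |z| ≤ 1) (hz' : |z'| ≤ 1)
    (h : gnomonicHeight t z ≤ gnomonicHeight t' z') : z ≤ z' + |t - t'| := by
  have h1 := sphericalHeight_mono t (abs_gnomonicHeight_le t hz) (abs_gnomonicHeight_le t' hz') h
  have h2 := abs_sphericalHeight_sub_le (abs_gnomonicHeight_le t' hz') t t'
  rw [sphericalHeight_gnomonicHeight] at h1
  rw [sphericalHeight_gnomonicHeight] at h2
  linarith [(abs_le.1 h2).2]

/-! ### The meridian sections of a spherical convex set -/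

/-- The point of the unit sphere at longitude `2πx` and height `z`. -/
def sphereVec (x z : ℝ) : Fin 3 → ℝ :=
  ![√(1 - z ^ 2) * Real.cos (2 * Real.pi * x), √(1 - z ^ 2) * Real.sin (2 * Real.pi * x), z]

theorem lambertVec_eq_sphereVec (x y : ℝ) : lambertVec (x, y) = sphereVec x (1 - 2 * y) := by
  have : √(1 - (1 - 2 * y) ^ 2) = 2 * √(y - y ^ 2) := by
    rw [show 1 - (1 - 2 * y) ^ 2 = 2 ^ 2 * (y - y ^ 2) by ring, Real.sqrt_mul (by norm_num),
      Real.sqrt_sq (by norm_num)]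
  simp only [lambertVec, sphereVec, this]

theorem norm_toLp_sphereVec (x : ℝ) {z : ℝ} (hz : z ∈ Icc (-1 : ℝ) 1) :
    ‖(WithLp.toLp 2 (sphereVec x z) : EuclideanSpace ℝ (Fin 3))‖ = 1 := by
  have hs := Real.sq_sqrt (show 0 ≤ 1 - z ^ 2 by nlinarith [hz.1, hz.2])
  have ht := Real.sin_sq_add_cos_sq (2 * Real.pi * x)
  rw [EuclideanSpace.norm_eq, Real.sqrt_eq_one]
  simp only [Real.norm_eq_abs, sq_abs, Fin.sum_univ_three, sphereVec, Matrix.cons_val]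
  linear_combination √(1 - z ^ 2) ^ 2 * ht + hs

/-- The heights at which the meridian of longitude `2πx` meets the set `C`. -/
def heights (C : Set Sphere2) (x : ℝ) : Set ℝ :=
  {z | z ∈ Icc (-1 : ℝ) 1 ∧
    ∃ p ∈ C, (p : EuclideanSpace ℝ (Fin 3)) = WithLp.toLp 2 (sphereVec x z)}

theorem lambert_mem_iff {C : Set Sphere2} (p : I × I) :
    lambert p ∈ C ↔ 1 - 2 * (p.2 : ℝ) ∈ heights C p.1 := by
  have e : (lambert p : EuclideanSpace ℝ (Fin 3)) =
      WithLp.toLp 2 (sphereVec p.1 (1 - 2 * (p.2 : ℝ))) := by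
    rw [coe_lambert, lambertVec_eq_sphereVec]
  constructor
  · exact fun h => ⟨⟨by linarith [p.2.2.2], by linarith [p.2.2.1]⟩, _, h, e⟩
  · rintro ⟨-, q, hq, h⟩
    rwa [Subtype.ext (e.trans h.symm)]

theorem isClosed_heights {C : Set Sphere2} (hC : IsClosed C) (x : ℝ) :
    IsClosed (heights C x) := by
  have h1 : IsClosed ((↑) '' C : Set (EuclideanSpace ℝ (Fin 3))) :=
    Metric.isClosed_sphere.isClosedEmbedding_subtypeVal.isClosedMap _ hC
  have h2 : Continuous fun z : ℝ =>
      (WithLp.toLp 2 (sphereVec x z) : EuclideanSpace ℝ (Fin 3)) := by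
    refine (PiLp.continuous_toLp 2 _).comp (continuous_pi fun i => ?_)
    fin_cases i <;> simp [sphereVec] <;> fun_prop
  exact isClosed_Icc.inter (h1.preimage h2)

theorem heights_of_combination {C : Set Sphere2} (hC : C ∈ sphericalConvexSets)
    {x₁ x₂ x₃ z₁ z₂ z₃ a b : ℝ} (h₁ : z₁ ∈ heights C x₁)
    (h₃ : z₃ ∈ heights C x₃) (h₂ : z₂ ∈ Icc (-1 : ℝ) 1) (ha : 0 ≤ a) (hb : 0 ≤ b)
    (h : ∀ i, sphereVec x₂ z₂ i = a * sphereVec x₁ z₁ i + b * sphereVec x₃ z₃ i) :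
    z₂ ∈ heights C x₂ := by
  obtain ⟨-, p, hp, ep⟩ := h₁
  obtain ⟨-, q, hq, eq⟩ := h₃
  refine ⟨h₂, ⟨WithLp.toLp 2 (sphereVec x₂ z₂),
    mem_sphere_zero_iff_norm.2 (norm_toLp_sphereVec x₂ h₂)⟩, hC.2.2 p hp q hq ⟨a, b, ha, hb, ?_⟩, rfl⟩
  rw [ep, eq]
  ext i
  exact h i

theorem not_both_poles {C : Set Sphere2} (hC : C ∈ sphericalConvexSets) {x x' : ℝ}
    (h : -1 ∈ heights C x) (h' : 1 ∈ heights C x') : False := by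
  obtain ⟨v, hv⟩ := hC.2.1
  obtain ⟨-, p, hp, ep⟩ := h
  obtain ⟨-, q, hq, eq⟩ := h'
  have h1 := hv p hp
  have h2 := hv q hq
  rw [ep] at h1
  rw [eq] at h2
  simp [PiLp.inner_apply, Fin.sum_univ_three, sphereVec] at h1 h2
  linarith

theorem sqrt_mul_sub_mul_sqrt {z z' : ℝ} (hz : z ∈ Icc (-1 : ℝ) 1) (hz' : z' ∈ Icc (-1 : ℝ) 1) :
    √(1 - z ^ 2) * z' - z * √(1 - z' ^ 2) = Real.sin (Real.arcsin z' - Real.arcsin z) := by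
  rw [Real.sin_sub, Real.sin_arcsin hz.1 hz.2, Real.sin_arcsin hz'.1 hz'.2, Real.cos_arcsin,
    Real.cos_arcsin]
  ring

/-- Each meridian section is an interval: the geodesic between two points of a meridian,
not both of them poles, runs along the meridian. -/
theorem heights_ordConnected {C : Set Sphere2} (hC : C ∈ sphericalConvexSets) (x : ℝ)
    {z₁ z₂ z₃ : ℝ} (h₁ : z₁ ∈ heights C x)
    (h₃ : z₃ ∈ heights C x) (h12 : z₁ ≤ z₂) (h23 : z₂ ≤ z₃) : z₂ ∈ heights C x := by
  rcases h12.eq_or_lt with rfl | h12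
  · exact h₁
  rcases h23.eq_or_lt with rfl | h23
  · exact h₃
  have m1 := h₁.1
  have m3 := h₃.1
  have m2 : z₂ ∈ Icc (-1 : ℝ) 1 := ⟨m1.1.trans h12.le, h23.le.trans m3.2⟩
  have a12 := Real.strictMonoOn_arcsin m1 m2 h12
  have a23 := Real.strictMonoOn_arcsin m2 m3 h23
  have l1 := Real.neg_pi_div_two_le_arcsin z₁
  have u3 := Real.arcsin_le_pi_div_two z₃
  have hΔ : 0 < √(1 - z₁ ^ 2) * z₃ - z₁ * √(1 - z₃ ^ 2) := by
    rw [sqrt_mul_sub_mul_sqrt m1 m3]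
    refine Real.sin_pos_of_pos_of_lt_pi (by linarith) ?_
    by_contra hle
    have e1 : Real.arcsin z₁ = -(Real.pi / 2) := by linarith
    have e3 : Real.arcsin z₃ = Real.pi / 2 := by linarith
    have e1' : z₁ = -1 := by
      rw [← Real.sin_arcsin m1.1 m1.2, e1, Real.sin_neg, Real.sin_pi_div_two]
    have e3' : z₃ = 1 := by
      rw [← Real.sin_arcsin m3.1 m3.2, e3, Real.sin_pi_div_two]
    exact not_both_poles hC (e1' ▸ h₁) (e3' ▸ h₃)
  have hα : 0 ≤ √(1 - z₂ ^ 2) * z₃ - z₂ * √(1 - z₃ ^ 2) := by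
    rw [sqrt_mul_sub_mul_sqrt m2 m3]
    exact Real.sin_nonneg_of_nonneg_of_le_pi (by linarith) (by linarith)
  have hβ : 0 ≤ √(1 - z₁ ^ 2) * z₂ - z₁ * √(1 - z₂ ^ 2) := by
    rw [sqrt_mul_sub_mul_sqrt m1 m2]
    exact Real.sin_nonneg_of_nonneg_of_le_pi (by linarith) (by linarith)
  refine heights_of_combination hC h₁ h₃ m2 (div_nonneg hα hΔ.le) (div_nonneg hβ hΔ.le) fun i => ?_
  rw [div_mul_eq_mul_div, div_mul_eq_mul_div, ← add_div, eq_div_iff hΔ.ne']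
  fin_cases i <;>
    simp only [sphereVec, Fin.zero_eta, Fin.mk_one, Fin.reduceFinMk, Matrix.cons_val] <;> ring

/-- The ordinate in the gnomonic plane determines the gnomonic height. -/
theorem gnomonicHeight_eq {φ z c : ℝ} (hφ : 0 < Real.cos φ) (hc : 0 < c)
    (hz : z ^ 2 + c ^ 2 = 1) :
    gnomonicHeight (Real.tan φ) z = Real.sin (Real.arctan (z / (c * Real.cos φ))) := by
  have h1 : √(1 + Real.tan φ ^ 2) = (Real.cos φ)⁻¹ := by
    rw [← inv_inv (√(1 + Real.tan φ ^ 2)), Real.inv_sqrt_one_add_tan_sq hφ]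
  have h2 : 1 + (z / (c * Real.cos φ)) ^ 2 =
      (1 + Real.tan φ ^ 2 * z ^ 2) / c ^ 2 := by
    rw [Real.tan_eq_sin_div_cos]
    field_simp
    linear_combination Real.cos φ ^ 2 * hz - z ^ 2 * Real.sin_sq_add_cos_sq φ
  rw [Real.sin_arctan, h2, Real.sqrt_div (by positivity), Real.sqrt_sq hc.le, gnomonicHeight, h1]
  field_simp

theorem min_le_weighted_mean {α β u v : ℝ} (hα : 0 < α) (hβ : 0 < β) :
    min u v ≤ (α * u + β * v) / (α + β) := by
  rw [le_div_iff₀ (by positivity)]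
  have h1 := mul_le_mul_of_nonneg_left (min_le_left u v) hα.le
  have h2 := mul_le_mul_of_nonneg_left (min_le_right u v) hβ.le
  linarith

theorem weighted_mean_le_max {α β u v : ℝ} (hα : 0 < α) (hβ : 0 < β) :
    (α * u + β * v) / (α + β) ≤ max u v := by
  rw [div_le_iff₀ (by positivity)]
  have h1 := mul_le_mul_of_nonneg_left (le_max_left u v) hα.le
  have h2 := mul_le_mul_of_nonneg_left (le_max_right u v) hβ.le
  linarith

/-- Within an octant on each side of the longitude `θ`, the geodesic between two points of `C`
projects to a segment of the gnomonic plane, so its gnomonic heights lie between those of its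
endpoints. -/
theorem exists_gnomonicHeight_between {C : Set Sphere2} (hC : C ∈ sphericalConvexSets)
    {θ : ℝ} {x₁ x₂ x₃ z₁ z₃ : ℝ}
    (hθ₁ : -(Real.pi / 4) ≤ 2 * Real.pi * x₁ - θ) (hθ₃ : 2 * Real.pi * x₃ - θ ≤ Real.pi / 4)
    (h12 : x₁ < x₂) (h23 : x₂ < x₃) (h₁ : z₁ ∈ heights C x₁) (h₃ : z₃ ∈ heights C x₃) :
    ∃ z₂ ∈ heights C x₂,
      min (gnomonicHeight (Real.tan (2 * Real.pi * x₁ - θ)) z₁)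
          (gnomonicHeight (Real.tan (2 * Real.pi * x₃ - θ)) z₃) ≤
        gnomonicHeight (Real.tan (2 * Real.pi * x₂ - θ)) z₂ ∧
      gnomonicHeight (Real.tan (2 * Real.pi * x₂ - θ)) z₂ ≤
        max (gnomonicHeight (Real.tan (2 * Real.pi * x₁ - θ)) z₁)
          (gnomonicHeight (Real.tan (2 * Real.pi * x₃ - θ)) z₃) := by
  have hpi := Real.pi_pos
  have pole : ∀ x x' z : ℝ, z = 1 ∨ z = -1 → sphereVec x z = sphereVec x' z := by
    rintro x x' z (rfl | rfl) <;> simp [sphereVec]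
  have hpole : ∀ x, ∀ z ∈ heights C x, z = 1 ∨ z = -1 → z ∈ heights C x₂ := by
    rintro x z ⟨hz, p, hp, e⟩ h
    exact ⟨hz, p, hp, by rw [e, pole x x₂ z h]⟩
  have hgn : ∀ t t' z : ℝ, z = 1 ∨ z = -1 → gnomonicHeight t z = gnomonicHeight t' z := by
    rintro t t' z (rfl | rfl) <;> simp [gnomonicHeight_one, gnomonicHeight_neg_one]
  by_cases hp1 : z₁ = 1 ∨ z₁ = -1
  · refine ⟨z₁, hpole x₁ z₁ h₁ hp1, ?_, ?_⟩ <;>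
      rw [hgn (Real.tan (2 * Real.pi * x₂ - θ)) (Real.tan (2 * Real.pi * x₁ - θ)) z₁ hp1]
    exacts [min_le_left _ _, le_max_left _ _]
  by_cases hp3 : z₃ = 1 ∨ z₃ = -1
  · refine ⟨z₃, hpole x₃ z₃ h₃ hp3, ?_, ?_⟩ <;>
      rw [hgn (Real.tan (2 * Real.pi * x₂ - θ)) (Real.tan (2 * Real.pi * x₃ - θ)) z₃ hp3]
    exacts [min_le_right _ _, le_max_right _ _]
  have hc : ∀ x, ∀ z ∈ heights C x, ¬(z = 1 ∨ z = -1) →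
      0 < √(1 - z ^ 2) ∧ z ^ 2 + √(1 - z ^ 2) ^ 2 = 1 := by
    rintro x z ⟨hz, -⟩ h
    rw [← sq_eq_one_iff] at h
    have hlt : z ^ 2 < 1 := lt_of_le_of_ne (by nlinarith [hz.1, hz.2]) h
    refine ⟨Real.sqrt_pos.2 (by linarith), ?_⟩
    rw [Real.sq_sqrt (by linarith)]
    ring
  obtain ⟨hc1, hs1⟩ := hc x₁ z₁ h₁ hp1
  obtain ⟨hc3, hs3⟩ := hc x₃ z₃ h₃ hp3
  have hx12 : 2 * Real.pi * x₁ < 2 * Real.pi * x₂ := by gcongr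
  have hx23 : 2 * Real.pi * x₂ < 2 * Real.pi * x₃ := by gcongr
  have hcos : ∀ φ : ℝ, -(Real.pi / 4) ≤ φ → φ ≤ Real.pi / 4 → 0 < Real.cos φ := fun φ h h' =>
    Real.cos_pos_of_mem_Ioo ⟨by linarith, by linarith⟩
  have k1 := hcos (2 * Real.pi * x₁ - θ) hθ₁ (by linarith)
  have k2 := hcos (2 * Real.pi * x₂ - θ) (by linarith) (by linarith)
  have k3 := hcos (2 * Real.pi * x₃ - θ) (by linarith) hθ₃
  have s32 : 0 < Real.sin (2 * Real.pi * x₃ - 2 * Real.pi * x₂) :=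
    Real.sin_pos_of_pos_of_lt_pi (by linarith) (by linarith)
  have s21 : 0 < Real.sin (2 * Real.pi * x₂ - 2 * Real.pi * x₁) :=
    Real.sin_pos_of_pos_of_lt_pi (by linarith) (by linarith)
  have s31 : 0 < Real.sin (2 * Real.pi * x₃ - 2 * Real.pi * x₁) :=
    Real.sin_pos_of_pos_of_lt_pi (by linarith) (by linarith)
  -- the identity `sin (c - a) f(b) = sin (c - b) f(a) + sin (b - a) f(c)` for `f` a sinusoid
  have idc : ∀ δ : ℝ, Real.sin (2 * Real.pi * x₃ - 2 * Real.pi * x₁) *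
      Real.cos (2 * Real.pi * x₂ - δ) =
      Real.sin (2 * Real.pi * x₃ - 2 * Real.pi * x₂) * Real.cos (2 * Real.pi * x₁ - δ) +
      Real.sin (2 * Real.pi * x₂ - 2 * Real.pi * x₁) * Real.cos (2 * Real.pi * x₃ - δ) := by
    intro δ
    simp only [Real.sin_sub, Real.cos_sub]
    ring
  have ids : Real.sin (2 * Real.pi * x₃ - 2 * Real.pi * x₁) * Real.sin (2 * Real.pi * x₂) =
      Real.sin (2 * Real.pi * x₃ - 2 * Real.pi * x₂) * Real.sin (2 * Real.pi * x₁) +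
      Real.sin (2 * Real.pi * x₂ - 2 * Real.pi * x₁) * Real.sin (2 * Real.pi * x₃) := by
    simp only [Real.sin_sub]
    ring
  have id0 := idc 0
  have idθ := idc θ
  simp only [sub_zero] at id0
  set S32 := Real.sin (2 * Real.pi * x₃ - 2 * Real.pi * x₂)
  set S21 := Real.sin (2 * Real.pi * x₂ - 2 * Real.pi * x₁)
  set S31 := Real.sin (2 * Real.pi * x₃ - 2 * Real.pi * x₁)
  set c₁ := √(1 - z₁ ^ 2)
  set c₃ := √(1 - z₃ ^ 2)
  -- the point on the geodesic, before normalization, has horizontal part of length `S31`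
  set ζ := S32 / c₁ * z₁ + S21 / c₃ * z₃ with hζ
  have hr2 : 0 < S31 ^ 2 + ζ ^ 2 := by positivity
  set r := √(S31 ^ 2 + ζ ^ 2) with hr
  have hrpos : 0 < r := Real.sqrt_pos.2 hr2
  have hrsq : r ^ 2 = S31 ^ 2 + ζ ^ 2 := Real.sq_sqrt hr2.le
  have hz2 : (ζ / r) ^ 2 + (S31 / r) ^ 2 = 1 := by
    rw [div_pow, div_pow, ← add_div, add_comm, ← hrsq, div_self (by positivity)]
  have hc2 : √(1 - (ζ / r) ^ 2) = S31 / r := by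
    rw [← hz2, add_sub_cancel_left, Real.sqrt_sq (by positivity)]
  have hz2I : ζ / r ∈ Icc (-1 : ℝ) 1 := by
    rw [mem_Icc, ← abs_le, ← sq_le_one_iff_abs_le_one]
    nlinarith [sq_nonneg (S31 / r)]
  refine ⟨ζ / r, heights_of_combination hC h₁ h₃ hz2I (a := S32 / c₁ / r) (b := S21 / c₃ / r)
    (by positivity) (by positivity) fun i => ?_, ?_⟩
  · fin_cases i
    · change √(1 - (ζ / r) ^ 2) * _ = S32 / c₁ / r * (c₁ * _) + S21 / c₃ / r * (c₃ * _)
      rw [hc2]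
      field_simp
      exact id0
    · change √(1 - (ζ / r) ^ 2) * _ = S32 / c₁ / r * (c₁ * _) + S21 / c₃ / r * (c₃ * _)
      rw [hc2]
      field_simp
      exact ids
    · change ζ / r = S32 / c₁ / r * z₁ + S21 / c₃ / r * z₃
      rw [hζ]
      ring
  · rw [gnomonicHeight_eq k1 hc1 hs1, gnomonicHeight_eq k3 hc3 hs3,
      gnomonicHeight_eq k2 (by positivity : 0 < S31 / r) hz2]
    set u₁ := z₁ / (c₁ * Real.cos (2 * Real.pi * x₁ - θ)) with hu1
    set u₃ := z₃ / (c₃ * Real.cos (2 * Real.pi * x₃ - θ)) with hu3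
    -- the middle ordinate is a weighted mean of the outer ones
    have hu2 : ζ / r / (S31 / r * Real.cos (2 * Real.pi * x₂ - θ)) =
        (S32 * Real.cos (2 * Real.pi * x₁ - θ) * u₁ +
          S21 * Real.cos (2 * Real.pi * x₃ - θ) * u₃) /
        (S32 * Real.cos (2 * Real.pi * x₁ - θ) + S21 * Real.cos (2 * Real.pi * x₃ - θ)) := by
      rw [← idθ, hu1, hu3, hζ]
      field_simp
    rw [hu2]
    have p1 : 0 < S32 * Real.cos (2 * Real.pi * x₁ - θ) := by positivity
    have p3 : 0 < S21 * Real.cos (2 * Real.pi * x₃ - θ) := by positivity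
    set α := S32 * Real.cos (2 * Real.pi * x₁ - θ)
    set β := S21 * Real.cos (2 * Real.pi * x₃ - θ)
    have hmono : Monotone fun u => Real.sin (Real.arctan u) := by
      intro u v huv
      exact Real.strictMonoOn_sin.monotoneOn
        ⟨(Real.neg_pi_div_two_lt_arctan u).le, (Real.arctan_lt_pi_div_two u).le⟩
        ⟨(Real.neg_pi_div_two_lt_arctan v).le, (Real.arctan_lt_pi_div_two v).le⟩
        (Real.arctan_mono huv)
    have e1 := hmono.map_min (a := u₁) (b := u₃)
    have e2 := hmono.map_max (a := u₁) (b := u₃)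
    rw [← e1, ← e2]
    exact ⟨hmono (min_le_weighted_mean p1 p3), hmono (weighted_mean_le_max p1 p3)⟩

/-! ### The upper and lower boundary of a spherical convex set -/

/-- The greatest height of `C` on the meridian of longitude `2πx`, and `-1` if there is none. -/
def topHeight (C : Set Sphere2) (x : ℝ) : ℝ := sSup (insert (-1) (heights C x))

/-- The least height of `C` on the meridian of longitude `2πx`, and `1` if there is none. -/
def bottomHeight (C : Set Sphere2) (x : ℝ) : ℝ := sInf (insert 1 (heights C x))

theorem insert_heights_subset {C : Set Sphere2} {x e : ℝ} (he : e ∈ Icc (-1 : ℝ) 1) :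
    insert e (heights C x) ⊆ Icc (-1) 1 :=
  insert_subset he fun _ h => h.1

theorem topHeight_mem {C : Set Sphere2} (hC : IsClosed C) (x : ℝ) :
    topHeight C x ∈ insert (-1) (heights C x) :=
  IsClosed.csSup_mem (insert_eq (-1 : ℝ) _ ▸ isClosed_singleton.union (isClosed_heights hC x))
    (insert_nonempty _ _) (bddAbove_Icc.mono (insert_heights_subset (by simp)))

theorem bottomHeight_mem {C : Set Sphere2} (hC : IsClosed C) (x : ℝ) :
    bottomHeight C x ∈ insert 1 (heights C x) :=
  IsClosed.csInf_mem (insert_eq (1 : ℝ) _ ▸ isClosed_singleton.union (isClosed_heights hC x))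
    (insert_nonempty _ _) (bddBelow_Icc.mono (insert_heights_subset (by simp)))

theorem le_topHeight {C : Set Sphere2} {x z : ℝ} (h : z ∈ insert (-1) (heights C x)) :
    z ≤ topHeight C x :=
  le_csSup (bddAbove_Icc.mono (insert_heights_subset (by simp))) h

theorem bottomHeight_le {C : Set Sphere2} {x z : ℝ} (h : z ∈ insert 1 (heights C x)) :
    bottomHeight C x ≤ z :=
  csInf_le (bddBelow_Icc.mono (insert_heights_subset (by simp))) h

theorem abs_topHeight_le {C : Set Sphere2} (hC : IsClosed C) (x : ℝ) : |topHeight C x| ≤ 1 :=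
  abs_le.2 (insert_heights_subset (by simp) (topHeight_mem hC x))

theorem abs_bottomHeight_le {C : Set Sphere2} (hC : IsClosed C) (x : ℝ) :
    |bottomHeight C x| ≤ 1 :=
  abs_le.2 (insert_heights_subset (by simp) (bottomHeight_mem hC x))

theorem mem_heights_iff {C : Set Sphere2} (hC : C ∈ sphericalConvexSets) {x z : ℝ} :
    z ∈ heights C x ↔ bottomHeight C x ≤ z ∧ z ≤ topHeight C x := by
  refine ⟨fun h => ⟨bottomHeight_le (.inr h), le_topHeight (.inr h)⟩, fun ⟨h1, h2⟩ => ?_⟩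
  have key : ∀ w ∈ heights C x, bottomHeight C x ∈ heights C x ∧ topHeight C x ∈ heights C x := by
    intro w hw
    constructor
    · rcases bottomHeight_mem hC.1 x with h | h
      · have := bottomHeight_le (.inr hw)
        rw [h] at this ⊢
        rwa [le_antisymm this hw.1.2]
      · exact h
    · rcases topHeight_mem hC.1 x with h | h
      · have := le_topHeight (.inr hw)
        rw [h] at this ⊢
        rwa [← le_antisymm this hw.1.1]
      · exact h
  have hmem : bottomHeight C x ∈ heights C x ∧ topHeight C x ∈ heights C x := by
    rcases bottomHeight_mem hC.1 x with hb | hb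
    · rcases topHeight_mem hC.1 x with ht | ht
      · linarith
      · exact key _ ht
    · exact key _ hb
  exact heights_ordConnected hC x hmem.1 hmem.2 h1 h2

/-- The tangent of the longitude, measured from the middle of the quarter `[a, a + 1/4]`. -/
theorem quarter_tan_spec (a : ℝ) :
    MonotoneOn (fun x => Real.tan (2 * Real.pi * x - (2 * Real.pi * a + Real.pi / 4)))
      (Icc a (a + 1 / 4)) ∧
    ∀ x ∈ Icc a (a + 1 / 4),
      |Real.tan (2 * Real.pi * x - (2 * Real.pi * a + Real.pi / 4))| ≤ 1 := by
  have hpi := Real.pi_pos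
  have hrange : ∀ x ∈ Icc a (a + 1 / 4),
      -(Real.pi / 4) ≤ 2 * Real.pi * x - (2 * Real.pi * a + Real.pi / 4) ∧
      2 * Real.pi * x - (2 * Real.pi * a + Real.pi / 4) ≤ Real.pi / 4 := by
    intro x hx
    constructor <;> nlinarith [hx.1, hx.2]
  have hmono : ∀ u v : ℝ, -(Real.pi / 4) ≤ u → u ≤ v → v ≤ Real.pi / 4 →
      Real.tan u ≤ Real.tan v := fun u v h1 h2 h3 =>
    Real.strictMonoOn_tan.monotoneOn ⟨by linarith, by linarith⟩ ⟨by linarith, by linarith⟩ h2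
  refine ⟨fun x hx y hy hxy => hmono _ _ (hrange x hx).1 ?_ (hrange y hy).2, fun x hx => ?_⟩
  · nlinarith
  · obtain ⟨h1, h2⟩ := hrange x hx
    rw [abs_le]
    constructor
    · rw [← Real.tan_pi_div_four, ← Real.tan_neg]
      exact hmono _ _ le_rfl h1 h2
    · rw [← Real.tan_pi_div_four]
      exact hmono _ _ h1 h2 le_rfl

theorem hasVariationLE_topHeight_quarter {C : Set Sphere2} (hC : C ∈ sphericalConvexSets) (a : ℝ) :
    HasVariationLE (topHeight C) a (a + 1 / 4) 10 := by
  have hpi := Real.pi_pos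
  obtain ⟨ht, ht1⟩ := quarter_tan_spec a
  refine hasVariationLE_of_quasiconcave (by linarith) ht ht1 (fun x _ => abs_topHeight_le hC.1 x)
    (q := fun x => gnomonicHeight
      (Real.tan (2 * Real.pi * x - (2 * Real.pi * a + Real.pi / 4))) (topHeight C x))
    (fun x _ y _ h => le_add_of_gnomonicHeight_le (abs_topHeight_le hC.1 x)
      (abs_topHeight_le hC.1 y) h) ?_
  intro x hx y _ z hz hxy hyz
  have hlow := (abs_le.1 (abs_gnomonicHeight_le
    (Real.tan (2 * Real.pi * y - (2 * Real.pi * a + Real.pi / 4))) (abs_topHeight_le hC.1 y))).1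
  rcases topHeight_mem hC.1 x with h1 | h1
  · refine (min_le_left _ _).trans ?_
    simp only [h1, gnomonicHeight_neg_one]
    exact hlow
  rcases topHeight_mem hC.1 z with h3 | h3
  · refine (min_le_right _ _).trans ?_
    simp only [h3, gnomonicHeight_neg_one]
    exact hlow
  obtain ⟨w, hw, hw1, -⟩ := exists_gnomonicHeight_between hC
    (θ := 2 * Real.pi * a + Real.pi / 4) (by nlinarith [hx.1]) (by nlinarith [hz.2]) hxy hyz h1 h3
  exact hw1.trans (gnomonicHeight_mono _ (le_topHeight (.inr hw)))

theorem hasVariationLE_bottomHeight_quarter {C : Set Sphere2} (hC : C ∈ sphericalConvexSets)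
    (a : ℝ) : HasVariationLE (bottomHeight C) a (a + 1 / 4) 10 := by
  have hpi := Real.pi_pos
  obtain ⟨ht, ht1⟩ := quarter_tan_spec a
  have hb : ∀ x, |-bottomHeight C x| ≤ 1 := fun x => by
    rw [abs_neg]; exact abs_bottomHeight_le hC.1 x
  have key : HasVariationLE (fun x => -bottomHeight C x) a (a + 1 / 4) 10 := by
    refine hasVariationLE_of_quasiconcave (by linarith) ht ht1 (fun x _ => hb x)
      (q := fun x => gnomonicHeight
        (Real.tan (2 * Real.pi * x - (2 * Real.pi * a + Real.pi / 4))) (-bottomHeight C x))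
      (fun x _ y _ h => le_add_of_gnomonicHeight_le (hb x) (hb y) h) ?_
    intro x hx y _ z hz hxy hyz
    simp only [gnomonicHeight_neg, min_neg_neg, neg_le_neg_iff]
    have hup := (abs_le.1 (abs_gnomonicHeight_le
      (Real.tan (2 * Real.pi * y - (2 * Real.pi * a + Real.pi / 4)))
      (abs_bottomHeight_le hC.1 y))).2
    rcases bottomHeight_mem hC.1 x with h1 | h1
    · refine le_trans ?_ (le_max_left _ _)
      rw [h1, gnomonicHeight_one]
      exact hup
    rcases bottomHeight_mem hC.1 z with h3 | h3
    · refine le_trans ?_ (le_max_right _ _)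
      rw [h3, gnomonicHeight_one]
      exact hup
    obtain ⟨w, hw, -, hw1⟩ := exists_gnomonicHeight_between hC
      (θ := 2 * Real.pi * a + Real.pi / 4) (by nlinarith [hx.1]) (by nlinarith [hz.2]) hxy hyz h1 h3
    exact (gnomonicHeight_mono _ (bottomHeight_le (.inr hw))).trans hw1
  simpa using key.neg

theorem HasVariationLE.of_quarters {h : ℝ → ℝ} {c : ℝ}
    (hq : ∀ a, HasVariationLE h a (a + 1 / 4) c) : HasVariationLE h 0 1 (4 * c) := by
  have h1 := hq 0
  have h2 := hq (1 / 4)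
  have h3 := hq (1 / 2)
  have h4 := hq (3 / 4)
  norm_num at h1 h2 h3 h4
  have := ((h1.trans (by norm_num) (by norm_num) h2).trans (by norm_num) (by norm_num) h3).trans
    (by norm_num) (by norm_num) h4
  convert this using 1
  ring

/-! ### Discrepancy of regions between two graphs of bounded variation -/

/-- `F` is a set function on the unit square, such as area or the proportion of points caught,
that exceeds the area of a rectangle by at most `D`. -/
structure RectangleBound (F : Set (I × I) → ℝ) (D : ℝ) : Prop where
  mono : ∀ S T, S ⊆ T → F S ≤ F T
  union : ∀ S T, F (S ∪ T) ≤ F S + F T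
  empty : F ∅ = 0
  rect : ∀ a b : I × I, a ≤ b → F (Icc a b) ≤ ((b.1 : ℝ) - a.1) * ((b.2 : ℝ) - a.2) + D

namespace RectangleBound

variable {F : Set (I × I) → ℝ} {D : ℝ}

theorem nonneg (hF : RectangleBound F D) : 0 ≤ D := by
  have h1 := hF.rect (0, 0) (0, 0) le_rfl
  have h2 := hF.mono ∅ (Icc (0, 0) (0, 0)) (empty_subset _)
  rw [hF.empty] at h2
  simp at h1
  exact h2.trans (by simpa using h1)

/-- A rectangle given by longitudes in `[x₀, x₁]` and heights in `[z₀, z₁]`. -/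
theorem heightRect (hF : RectangleBound F D) {x₀ x₁ z₀ z₁ : ℝ} (h0 : 0 ≤ x₀) (h01 : x₀ ≤ x₁)
    (h1 : x₁ ≤ 1) (hz0 : -1 ≤ z₀)
    (hz01 : z₀ ≤ z₁) (hz1 : z₁ ≤ 1) :
    F {p | (x₀ ≤ p.1 ∧ (p.1 : ℝ) ≤ x₁) ∧ z₀ ≤ 1 - 2 * (p.2 : ℝ) ∧ 1 - 2 * (p.2 : ℝ) ≤ z₁} ≤
      (x₁ - x₀) * ((z₁ - z₀) / 2) + D := by
  let a : I × I := (⟨x₀, h0, by linarith⟩, ⟨(1 - z₁) / 2, by linarith, by linarith⟩)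
  let b : I × I := (⟨x₁, by linarith, h1⟩, ⟨(1 - z₀) / 2, by linarith, by linarith⟩)
  have hab : a ≤ b := ⟨h01, show (1 - z₁) / 2 ≤ (1 - z₀) / 2 by linarith⟩
  refine (hF.mono _ (Icc a b) ?_).trans ((hF.rect a b hab).trans ?_)
  · rintro p ⟨⟨e1, e2⟩, e3, e4⟩
    exact ⟨⟨e1, show (1 - z₁) / 2 ≤ (p.2 : ℝ) by linarith⟩,
      ⟨e2, show (p.2 : ℝ) ≤ (1 - z₀) / 2 by linarith⟩⟩
  · show (x₁ - x₀) * ((1 - z₀) / 2 - (1 - z₁) / 2) + D ≤ _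
    apply le_of_eq
    ring

theorem exists_lt (hF : RectangleBound F D) (m : ℕ) (T : ℕ → Set (I × I)) :
    F {p | ∃ n < m, p ∈ T n} ≤ ∑ n ∈ Finset.range m, F (T n) := by
  induction m with
  | zero => simp [hF.empty]
  | succ m ih =>
    rw [Finset.sum_range_succ]
    refine ((hF.mono _ ({p | ∃ n < m, p ∈ T n} ∪ T m) ?_).trans (hF.union _ _)).trans
      (add_le_add_left ih _)
    rintro p ⟨n, hn, hp⟩
    rcases (Nat.lt_succ_iff_lt_or_eq).1 hn with h | rfl
    · exact .inl ⟨n, h, hp⟩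
    · exact .inr hp

end RectangleBound

/-- In a vertical strip on which `h` varies by `δ` about `a` and `g` by `ε` about `c`, the region
`g ≤ z ≤ h` lies in one rectangle, and its complement in two. Together they exceed the strip by
rectangles of heights `2δ` and `2ε` (in `z`). -/
theorem exists_strip_bound {A : Set (I × I)} {g h : ℝ → ℝ}
    (hA : ∀ p : I × I, p ∈ A ↔ g p.1 ≤ 1 - 2 * (p.2 : ℝ) ∧ 1 - 2 * (p.2 : ℝ) ≤ h p.1)
    {x₀ x₁ a c δ ε : ℝ} (h0 : 0 ≤ x₀) (h01 : x₀ ≤ x₁) (h1 : x₁ ≤ 1) (ha : |a| ≤ 1) (hc : |c| ≤ 1)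
    (hh : ∀ x, x₀ ≤ x → x ≤ x₁ → |a - h x| ≤ δ) (hg : ∀ x, x₀ ≤ x → x ≤ x₁ → |c - g x| ≤ ε) :
    ∃ u v : ℝ, u + v ≤ (x₁ - x₀) * (1 + δ + ε) ∧ ∀ F D, RectangleBound F D →
      F (A ∩ {p | x₀ ≤ p.1 ∧ (p.1 : ℝ) ≤ x₁}) ≤ u + D ∧
      F (Aᶜ ∩ {p | x₀ ≤ p.1 ∧ (p.1 : ℝ) ≤ x₁}) ≤ v + 2 * D := by
  rw [abs_le] at ha hc
  have hδ : 0 ≤ δ := (abs_nonneg _).trans (hh x₀ le_rfl h01)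
  have hε : 0 ≤ ε := (abs_nonneg _).trans (hg x₀ le_rfl h01)
  have hx : 0 ≤ x₁ - x₀ := by linarith
  have hz : ∀ p : I × I, -1 ≤ 1 - 2 * (p.2 : ℝ) ∧ 1 - 2 * (p.2 : ℝ) ≤ 1 := fun p =>
    ⟨by linarith [p.2.2.2], by linarith [p.2.2.1]⟩
  rcases le_or_gt (c - ε) (a + δ) with hcase | hcase
  · set zu := min 1 (a + δ)
    set zl := max (-1) (c - ε)
    set yl := max (-1) (a - δ)
    set yu := min 1 (c + ε)
    have b1 : zu ≤ a + δ := min_le_right _ _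
    have b2 : c - ε ≤ zl := le_max_right _ _
    have b3 : a - δ ≤ yl := le_max_right _ _
    have b4 : yu ≤ c + ε := min_le_right _ _
    have b5 : zl ≤ zu := max_le (le_min (by norm_num) (by linarith)) (le_min (by linarith) hcase)
    have b6 : zu ≤ 1 := min_le_left _ _
    have b7 : -1 ≤ zl := le_max_left _ _
    have b8 : yu ≤ 1 := min_le_left _ _
    have b9 : -1 ≤ yl := le_max_left _ _
    have b10 : -1 ≤ yu := le_min (by norm_num) (by linarith)
    have b11 : yl ≤ 1 := max_le (by norm_num) (by linarith)
    refine ⟨(x₁ - x₀) * ((zu - zl) / 2),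
      (x₁ - x₀) * ((yu - -1) / 2) + (x₁ - x₀) * ((1 - yl) / 2), ?_, fun F D hF => ⟨?_, ?_⟩⟩
    · rw [← mul_add, ← mul_add]
      exact mul_le_mul_of_nonneg_left (by linarith) hx
    · refine (hF.mono _ _ ?_).trans (hF.heightRect h0 h01 h1 b7 b5 b6)
      rintro p ⟨hp, hp0, hp1⟩
      have e1 := abs_le.1 (hh p.1 hp0 hp1)
      have e2 := abs_le.1 (hg p.1 hp0 hp1)
      obtain ⟨e3, e4⟩ := (hA p).1 hp
      exact ⟨⟨hp0, hp1⟩, max_le (hz p).1 (by linarith), le_min (hz p).2 (by linarith)⟩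
    · have r1 := hF.heightRect h0 h01 h1 le_rfl b10 b8
      have r2 := hF.heightRect h0 h01 h1 b9 b11 le_rfl
      refine ((hF.mono _ _ ?_).trans ((hF.union _ _).trans (add_le_add r1 r2))).trans (by linarith)
      rintro p ⟨hp, hp0, hp1⟩
      have e1 := abs_le.1 (hh p.1 hp0 hp1)
      have e2 := abs_le.1 (hg p.1 hp0 hp1)
      rw [mem_compl_iff, hA, not_and_or, not_le, not_le] at hp
      rcases hp with hp | hp
      · exact .inl ⟨⟨hp0, hp1⟩, (hz p).1, le_min (hz p).2 (by linarith)⟩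
      · exact .inr ⟨⟨hp0, hp1⟩, max_le (hz p).1 (by linarith), (hz p).2⟩
  · refine ⟨0, (x₁ - x₀) * ((1 - -1) / 2), ?_, fun F D hF => ⟨?_, ?_⟩⟩
    · rw [zero_add]
      exact mul_le_mul_of_nonneg_left (by linarith) hx
    · have : A ∩ {p | x₀ ≤ p.1 ∧ (p.1 : ℝ) ≤ x₁} = ∅ := by
        rw [eq_empty_iff_forall_notMem]
        rintro p ⟨hp, hp0, hp1⟩
        have e1 := abs_le.1 (hh p.1 hp0 hp1)
        have e2 := abs_le.1 (hg p.1 hp0 hp1)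
        obtain ⟨e3, e4⟩ := (hA p).1 hp
        linarith
      rw [this, hF.empty, zero_add]
      exact hF.nonneg
    · have r := hF.heightRect h0 h01 h1 le_rfl (by norm_num : (-1 : ℝ) ≤ 1) le_rfl
      refine ((hF.mono _ _ ?_).trans r).trans (by linarith [hF.nonneg])
      rintro p ⟨-, hp0, hp1⟩
      exact ⟨⟨hp0, hp1⟩, hz p⟩

/-- Cutting the square into `m` vertical strips, the strip bounds add up to an excess of the total
variation divided by `m`. -/
theorem exists_region_bound {A : Set (I × I)} {g h : ℝ → ℝ}
    (hA : ∀ p : I × I, p ∈ A ↔ g p.1 ≤ 1 - 2 * (p.2 : ℝ) ∧ 1 - 2 * (p.2 : ℝ) ≤ h p.1)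
    (hg1 : ∀ x, |g x| ≤ 1) (hh1 : ∀ x, |h x| ≤ 1) {V : ℝ} (hg : HasVariationLE g 0 1 V)
    (hh : HasVariationLE h 0 1 V) {m : ℕ} (hm : 0 < m) :
    ∃ u v : ℝ, u + v ≤ 1 + 2 * V / m ∧ ∀ F D, RectangleBound F D →
      F A ≤ u + m * D ∧ F Aᶜ ≤ v + 2 * m * D := by
  obtain ⟨Γ, hΓ, hΓV⟩ := hg
  obtain ⟨Φ, hΦ, hΦV⟩ := hh
  have hm' : (0 : ℝ) < m := by exact_mod_cast hm
  have key : ∀ n : ℕ, ∃ u v : ℝ, n < m → (u + v ≤ 1 / m *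
      (1 + (Φ ((n + 1 : ℕ) / m) - Φ ((n : ℕ) / m)) + (Γ ((n + 1 : ℕ) / m) - Γ ((n : ℕ) / m))) ∧
      ∀ F D, RectangleBound F D →
      F (A ∩ {p | (n : ℝ) / m ≤ p.1 ∧ (p.1 : ℝ) ≤ (n + 1 : ℕ) / m}) ≤ u + D ∧
      F (Aᶜ ∩ {p | (n : ℝ) / m ≤ p.1 ∧ (p.1 : ℝ) ≤ (n + 1 : ℕ) / m}) ≤ v + 2 * D) := by
    intro n
    by_cases hn : n < m
    · have i0 : (0 : ℝ) ≤ (n : ℝ) / m := by positivity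
      have i1 : (n : ℝ) / m ≤ (n + 1 : ℕ) / m := by gcongr; simp
      have i2 : ((n + 1 : ℕ) : ℝ) / m ≤ 1 := by
        rw [div_le_one hm']; exact_mod_cast hn
      have hw : ((n + 1 : ℕ) : ℝ) / m - n / m = 1 / m := by push_cast; ring
      obtain ⟨u, v, huv, hF⟩ := exists_strip_bound hA i0 i1 i2 (hh1 (n / m)) (hg1 (n / m))
        (δ := Φ ((n + 1 : ℕ) / m) - Φ ((n : ℕ) / m)) (ε := Γ ((n + 1 : ℕ) / m) - Γ ((n : ℕ) / m))
        (fun x hx hx' => (hΦ _ x i0 hx (hx'.trans i2)).trans (by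
          linarith [(abs_nonneg _).trans (hΦ x _ (i0.trans hx) hx' i2)]))
        (fun x hx hx' => (hΓ _ x i0 hx (hx'.trans i2)).trans (by
          linarith [(abs_nonneg _).trans (hΓ x _ (i0.trans hx) hx' i2)]))
      rw [hw] at huv
      exact ⟨u, v, fun _ => ⟨huv, hF⟩⟩
    · exact ⟨0, 0, fun h => absurd h hn⟩
  choose u v huv using key
  refine ⟨∑ n ∈ Finset.range m, u n, ∑ n ∈ Finset.range m, v n, ?_, fun F D hF => ?_⟩
  · rw [← Finset.sum_add_distrib]
    refine (Finset.sum_le_sum fun n hn => (huv n (Finset.mem_range.1 hn)).1).trans ?_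
    rw [← Finset.mul_sum, Finset.sum_add_distrib, Finset.sum_add_distrib,
      Finset.sum_range_sub (fun n : ℕ => Φ (n / m)), Finset.sum_range_sub (fun n : ℕ => Γ (n / m))]
    simp only [Nat.cast_zero, zero_div, div_self hm'.ne', Finset.sum_const, Finset.card_range,
      nsmul_eq_mul, mul_one]
    rw [one_div, inv_mul_le_iff₀ hm', mul_add, mul_div_cancel₀ _ hm'.ne']
    linarith
  · have hcover : ∀ p : I × I, ∃ n < m, (n : ℝ) / m ≤ p.1 ∧ (p.1 : ℝ) ≤ (n + 1 : ℕ) / m := by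
      intro p
      have hp0 := p.1.2.1
      have hp1 := p.1.2.2
      rcases hp1.lt_or_eq with h1 | h1
      · refine ⟨⌊(m : ℝ) * p.1⌋₊, ?_, ?_, ?_⟩
        · rw [Nat.floor_lt (by positivity)]
          nlinarith
        · rw [div_le_iff₀ hm', mul_comm]
          exact Nat.floor_le (by positivity)
        · rw [le_div_iff₀ hm', mul_comm]
          push_cast
          exact (Nat.lt_floor_add_one _).le
      · refine ⟨m - 1, by omega, ?_, ?_⟩
        · rw [h1, div_le_one hm']; exact_mod_cast Nat.sub_le m 1
        · rw [Nat.sub_add_cancel hm, div_self hm'.ne', h1]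
    constructor
    · refine ((hF.mono _ _ fun p hp => ?_).trans (hF.exists_lt m fun n =>
        A ∩ {p | (n : ℝ) / m ≤ p.1 ∧ (p.1 : ℝ) ≤ (n + 1 : ℕ) / m})).trans
        ((Finset.sum_le_sum fun n hn =>
          ((huv n (Finset.mem_range.1 hn)).2 F D hF).1).trans (le_of_eq ?_))
      · obtain ⟨n, hn, h⟩ := hcover p
        exact ⟨n, hn, hp, h⟩
      · simp [Finset.sum_add_distrib]
    · refine ((hF.mono _ _ fun p hp => ?_).trans (hF.exists_lt m fun n =>
        Aᶜ ∩ {p | (n : ℝ) / m ≤ p.1 ∧ (p.1 : ℝ) ≤ (n + 1 : ℕ) / m})).trans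
        ((Finset.sum_le_sum fun n hn =>
          ((huv n (Finset.mem_range.1 hn)).2 F D hF).2).trans (le_of_eq ?_))
      · obtain ⟨n, hn, h⟩ := hcover p
        exact ⟨n, hn, hp, h⟩
      · simp [Finset.sum_add_distrib]
        ring

theorem rectangleBound_volume :
    RectangleBound (fun S => (volume : Measure (I × I)).real S) 0 where
  mono _ _ h := measureReal_mono h
  union _ _ := measureReal_union_le _ _
  empty := measureReal_empty
  rect a b h := by rw [volume_real_Icc_unitSquare h, add_zero]

/-- The proportion of the points of `Q` that lie in `S`. -/
def proportion (Q : Finset (I × I)) (S : Set (I × I)) : ℝ :=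
  (((Q : Set (I × I)) ∩ S).ncard : ℝ) / Q.card

theorem rectangleBound_proportion (Q : Finset (I × I)) :
    RectangleBound (proportion Q) (discrepancy volume axisRectangles Q) where
  mono S T h := by
    unfold proportion
    gcongr
    exact Q.finite_toSet.inter_of_left _
  union S T := by
    unfold proportion
    rw [← add_div, inter_union_distrib_left]
    gcongr
    exact_mod_cast ncard_union_le _ _
  empty := by simp [proportion]
  rect a b h := by
    have := le_discrepancy (volume : Measure (I × I)) axisRectangles Q ⟨a, b, h, rfl⟩
    simp only [probReal_univ, div_one, volume_real_Icc_unitSquare h] at this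
    have := (abs_le.1 this).2
    unfold proportion
    linarith

theorem proportion_add_compl {Q : Finset (I × I)} (hQ : Q.Nonempty) (S : Set (I × I)) :
    proportion Q S + proportion Q Sᶜ = 1 := by
  unfold proportion
  rw [← add_div, div_eq_one_iff_eq (by exact_mod_cast hQ.card_pos.ne')]
  norm_cast
  rw [← ncard_coe_finset Q, ← ncard_inter_add_ncard_sdiff_eq_ncard (Q : Set (I × I)) S Q.finite_toSet]
  rfl

/-- The pull-back of a spherical convex set, compared on `m` vertical strips. -/
theorem abs_proportion_sub_volume_le {C : Set Sphere2} (hC : C ∈ sphericalConvexSets)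
    {Q : Finset (I × I)} (hQ : Q.Nonempty) {m : ℕ} (hm : 0 < m) :
    |proportion Q (lambert ⁻¹' C) - (volume : Measure (I × I)).real (lambert ⁻¹' C)| ≤
      80 / m + 2 * m * discrepancy volume axisRectangles Q := by
  have hA : ∀ p : I × I, p ∈ lambert ⁻¹' C ↔
      bottomHeight C p.1 ≤ 1 - 2 * (p.2 : ℝ) ∧ 1 - 2 * (p.2 : ℝ) ≤ topHeight C p.1 := fun p => by
    rw [mem_preimage, lambert_mem_iff, mem_heights_iff hC]
  obtain ⟨u, v, huv, hF⟩ := exists_region_bound hA (abs_bottomHeight_le hC.1)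
    (abs_topHeight_le hC.1) (.of_quarters (hasVariationLE_bottomHeight_quarter hC))
    (.of_quarters (hasVariationLE_topHeight_quarter hC)) hm
  have hb := rectangleBound_proportion Q
  obtain ⟨e1, e2⟩ := hF _ _ rectangleBound_volume
  obtain ⟨e3, e4⟩ := hF _ _ hb
  have e5 := proportion_add_compl hQ (lambert ⁻¹' C)
  have e6 : (volume : Measure (I × I)).real (lambert ⁻¹' C) +
      (volume : Measure (I × I)).real (lambert ⁻¹' C)ᶜ = 1 := by
    rw [measureReal_add_measureReal_compl (hC.1.preimage continuous_lambert).measurableSet,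
      probReal_univ]
  have h0 : 0 ≤ (m : ℝ) * discrepancy volume axisRectangles Q :=
    mul_nonneg (Nat.cast_nonneg m) hb.nonneg
  norm_num at huv e1 e2
  rw [abs_le]
  constructor <;> linarith

/-! ### Passing to the image on the sphere -/

/-- The part of the unit square where the Lambert map may fail to be injective. -/
def seam : Set (I × I) := Icc (1, 0) (1, 1) ∪ (Icc (0, 0) (1, 0) ∪ Icc (0, 1) (1, 1))

theorem lambert_injOn_compl_seam : InjOn lambert seamᶜ := by
  have key : ∀ p : I × I, p ∈ seamᶜ → ((p.1 : ℝ), (p.2 : ℝ)) ∈ Ico (0 : ℝ) 1 ×ˢ Ioo (0 : ℝ) 1 := by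
    intro p hp
    simp only [seam, mem_compl_iff, mem_union, not_or] at hp
    obtain ⟨h1, h2, h3⟩ := hp
    have i0 : ∀ x : I, 0 ≤ x := fun x => x.2.1
    have i1 : ∀ x : I, x ≤ 1 := fun x => x.2.2
    refine ⟨⟨p.1.2.1, lt_of_le_of_ne p.1.2.2 fun h => h1 ?_⟩,
      lt_of_le_of_ne p.2.2.1 fun h => h2 ?_, lt_of_le_of_ne p.2.2.2 fun h => h3 ?_⟩
    · exact ⟨⟨(Subtype.ext h : p.1 = 1).ge, i0 _⟩, i1 _, i1 _⟩
    · exact ⟨⟨i0 _, i0 _⟩, i1 _, (Subtype.ext h : 0 = p.2).ge⟩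
    · exact ⟨⟨i0 _, (Subtype.ext h : p.2 = 1).ge⟩, i1 _, i1 _⟩
  intro p hp q hq h
  have h' := congrArg (fun z : Sphere2 => (z : EuclideanSpace ℝ (Fin 3))) h
  simp only [coe_lambert] at h'
  have := lambertVec_injOn (key p hp) (key q hq) (WithLp.toLp_injective 2 h')
  rw [Prod.mk.injEq] at this
  exact Prod.ext (Subtype.ext this.1) (Subtype.ext this.2)

theorem proportion_seam_le (Q : Finset (I × I)) :
    proportion Q seam ≤ 3 * discrepancy volume axisRectangles Q := by
  have hb := rectangleBound_proportion Q
  have h1 := hb.union (Icc (1, 0) (1, 1)) (Icc (0, 0) (1, 0) ∪ Icc (0, 1) (1, 1))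
  have h2 := hb.union (Icc (0, 0) (1, 0)) (Icc (0, 1) (1, 1))
  have r1 := hb.rect (1, 0) (1, 1) ⟨le_rfl, zero_le_one⟩
  have r2 := hb.rect (0, 0) (1, 0) ⟨zero_le_one, le_rfl⟩
  have r3 := hb.rect (0, 1) (1, 1) ⟨zero_le_one, le_rfl⟩
  simp only [sub_self, zero_mul, mul_zero, zero_add] at r1 r2 r3
  unfold seam
  linarith

/-- Identifying points on the seam changes the counts by at most the number of points there. -/
theorem abs_lambertImage_sub_proportion_le {Q : Finset (I × I)} (hQ : Q.Nonempty)
    (C : Set Sphere2) :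
    |(((lambertImage Q : Set Sphere2) ∩ C).ncard : ℝ) / (lambertImage Q).card -
      proportion Q (lambert ⁻¹' C)| ≤ 2 * proportion Q seam := by
  classical
  have hN : (0 : ℝ) < Q.card := by exact_mod_cast hQ.card_pos
  -- counts in the image, compared with counts in the square
  have key : ∀ X : Set Sphere2,
      ((lambertImage Q : Set Sphere2) ∩ X).ncard ≤ ((Q : Set (I × I)) ∩ lambert ⁻¹' X).ncard ∧
      ((Q : Set (I × I)) ∩ lambert ⁻¹' X).ncard ≤
        ((lambertImage Q : Set Sphere2) ∩ X).ncard + ((Q : Set (I × I)) ∩ seam).ncard := by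
    intro X
    have hco : (lambertImage Q : Set Sphere2) ∩ X =
        lambert '' ((Q : Set (I × I)) ∩ lambert ⁻¹' X) := by
      rw [image_inter_preimage, lambertImage, Finset.coe_image]
    have hfin : ((Q : Set (I × I)) ∩ lambert ⁻¹' X).Finite := Q.finite_toSet.inter_of_left _
    refine ⟨hco ▸ ncard_image_le hfin, ?_⟩
    have hinj : InjOn lambert (((Q : Set (I × I)) ∩ lambert ⁻¹' X) \ seam) :=
      lambert_injOn_compl_seam.mono fun p hp => hp.2
    have e1 : (((Q : Set (I × I)) ∩ lambert ⁻¹' X) \ seam).ncard ≤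
        ((lambertImage Q : Set Sphere2) ∩ X).ncard := by
      rw [hco, ← hinj.ncard_image]
      exact ncard_le_ncard (image_mono sdiff_subset) (hfin.image _)
    have e2 : (((Q : Set (I × I)) ∩ lambert ⁻¹' X) ∩ seam).ncard ≤
        ((Q : Set (I × I)) ∩ seam).ncard :=
      ncard_le_ncard (inter_subset_inter_left _ inter_subset_left) (Q.finite_toSet.inter_of_left _)
    rw [← ncard_inter_add_ncard_sdiff_eq_ncard _ seam hfin]
    omega
  obtain ⟨h1, h2⟩ := key C
  obtain ⟨h3, h4⟩ := key univ
  rw [inter_univ, preimage_univ, inter_univ, ncard_coe_finset, ncard_coe_finset] at h3 h4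
  have h5 : ((lambertImage Q : Set Sphere2) ∩ C).ncard ≤ (lambertImage Q).card := by
    rw [← ncard_coe_finset (lambertImage Q)]
    exact ncard_le_ncard inter_subset_left (Finset.finite_toSet _)
  have hn : (0 : ℝ) < (lambertImage Q).card := by
    exact_mod_cast (hQ.image lambert).card_pos
  unfold proportion
  generalize ((lambertImage Q : Set Sphere2) ∩ C).ncard = a' at *
  generalize ((Q : Set (I × I)) ∩ lambert ⁻¹' C).ncard = a at *
  generalize ((Q : Set (I × I)) ∩ seam).ncard = b at *
  generalize (lambertImage Q).card = n at *
  generalize Q.card = N at *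
  have h1' : (a' : ℝ) ≤ a := by exact_mod_cast h1
  have h2' : (a : ℝ) ≤ a' + b := by exact_mod_cast h2
  have h3' : (n : ℝ) ≤ N := by exact_mod_cast h3
  have h4' : (N : ℝ) ≤ n + b := by exact_mod_cast h4
  have h5' : (a' : ℝ) ≤ n := by exact_mod_cast h5
  have e : (a' : ℝ) / n - a / N = (a' / n * (N - n) + (a' - a)) / N := by
    field_simp
    ring
  have q0 : 0 ≤ (a' : ℝ) / n := by positivity
  have q1 : (a' : ℝ) / n ≤ 1 := (div_le_one hn).2 h5'
  rw [e, abs_div, abs_of_pos hN, ← mul_div_assoc]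
  gcongr
  rw [abs_le]
  constructor <;> nlinarith

/-- The discrepancy of the image on the sphere. -/
theorem discrepancy_lambertImage_le {Q : Finset (I × I)} (hQ : Q.Nonempty) {m : ℕ} (hm : 0 < m) :
    discrepancy surfaceMeasure sphericalConvexSets (lambertImage Q) ≤
      80 / m + 8 * m * discrepancy volume axisRectangles Q := by
  have hD : 0 ≤ discrepancy volume axisRectangles Q := (rectangleBound_proportion Q).nonneg
  have hm1 : (1 : ℝ) ≤ m := by exact_mod_cast hm
  have hmD := mul_le_mul_of_nonneg_right hm1 hD
  refine Real.sSup_le ?_ (by positivity)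
  rintro _ ⟨C, hC, rfl⟩
  dsimp only
  rw [surfaceMeasure_div hC.1.measurableSet]
  have e1 := abs_lambertImage_sub_proportion_le hQ C
  have e2 := abs_proportion_sub_volume_le hC hQ hm
  have e3 := proportion_seam_le Q
  refine (abs_sub_le _ (proportion Q (lambert ⁻¹' C)) _).trans ?_
  linarith

/-- The choice of about `√(N / log N)` strips balances the two error terms. -/
theorem discrepancy_lambertImage_le_sqrt {K : ℝ} {N : ℕ} (hN : 2 ≤ N)
    {Q : Finset (I × I)} (hQ : Q.card = N)
    (hD : discrepancy volume axisRectangles Q ≤ K * (Real.log N / N)) :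
    discrepancy surfaceMeasure sphericalConvexSets (lambertImage Q) ≤
      (80 + 16 * K) * √(Real.log N / N) := by
  have hN0 : (0 : ℝ) < N := by positivity
  have hlog : 0 < Real.log N := Real.log_pos (by exact_mod_cast hN)
  have hL : 0 < Real.log N / N := by positivity
  have hL1 : Real.log N / N ≤ 1 := by
    rw [div_le_one hN0]
    linarith [Real.log_le_sub_one_of_pos hN0]
  set L := Real.log N / N
  set r := √L with hr
  have hr0 : 0 < r := Real.sqrt_pos.2 hL
  have hr1 : r ≤ 1 := Real.sqrt_le_one.2 hL1
  have hrr : r * r = L := Real.mul_self_sqrt hL.le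
  have hm : 0 < ⌈1 / r⌉₊ := Nat.ceil_pos.2 (by positivity)
  have hne : Q.Nonempty := Finset.card_pos.1 (by omega)
  have hm1 : 1 / r ≤ (⌈1 / r⌉₊ : ℝ) := Nat.le_ceil _
  have hm2 : (⌈1 / r⌉₊ : ℝ) ≤ 2 / r := by
    have h1 := (Nat.ceil_lt_add_one (show 0 ≤ 1 / r by positivity)).le
    have h2 : 1 ≤ 1 / r := (one_le_div hr0).2 hr1
    calc (⌈1 / r⌉₊ : ℝ) ≤ 1 / r + 1 := h1
      _ ≤ 1 / r + 1 / r := by linarith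
      _ = 2 / r := by ring
  have hD0 := (rectangleBound_proportion Q).nonneg
  refine (discrepancy_lambertImage_le hne hm).trans ?_
  have e1 : 80 / (⌈1 / r⌉₊ : ℝ) ≤ 80 * r := by
    calc 80 / (⌈1 / r⌉₊ : ℝ) ≤ 80 / (1 / r) := by gcongr
      _ = 80 * r := by field_simp
  have e2 : 8 * (⌈1 / r⌉₊ : ℝ) * discrepancy volume axisRectangles Q ≤ 16 * K * r := by
    calc 8 * (⌈1 / r⌉₊ : ℝ) * discrepancy volume axisRectangles Q
        ≤ 8 * (2 / r) * (K * L) := by gcongr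
      _ = 16 * K * r := by rw [← hrr]; field_simp; ring
  linarith

end

theorem mainTheorem5 :
    -- the Lambert images of the Hammersley points form an efficient deterministic sampling
    IsEfficientSampling (fun N i => lambert (hammersleyPoint N i)) ∧
    -- it consists of `N` points
    (∀ N : ℕ, (hammersley N).card = N ∧ (lambertImage (hammersley N)).card = N) ∧
    -- the Hammersley set has low discrepancy in the unit square
    (∃ C : ℝ, ∀ N : ℕ, 2 ≤ N →
      discrepancy volume axisRectangles (hammersley N) ≤ C * (Real.log N / N)) ∧
    -- its Lambert image has low discrepancy against spherical convex sets
    (∃ C : ℝ, ∀ N : ℕ, 2 ≤ N →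
      discrepancy surfaceMeasure sphericalConvexSets (lambertImage (hammersley N))
        ≤ C * √(Real.log N / N)) ∧
    -- the same holds for every point set of optimal discrepancy in the unit square
    (∀ C : ℝ, ∃ C' : ℝ, ∀ N : ℕ, 2 ≤ N → ∀ Q : Finset (I × I), Q.card = N →
      discrepancy volume axisRectangles Q ≤ C * (Real.log N / N) →
      discrepancy surfaceMeasure sphericalConvexSets (lambertImage Q)
        ≤ C' * √(Real.log N / N)) := by
  refine ⟨isEfficientSampling_hammersley,
    fun N => ⟨card_hammersley N, card_lambertImage_hammersley N⟩, discrepancy_hammersley_le,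
    ?_, fun K => ⟨80 + 16 * K, fun N hN Q hQ => discrepancy_lambertImage_le_sqrt hN hQ⟩⟩
  obtain ⟨K, hK⟩ := discrepancy_hammersley_le
  exact ⟨80 + 16 * K, fun N hN =>
    discrepancy_lambertImage_le_sqrt hN (card_hammersley N) (hK N hN)⟩
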